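/- Let $\lambda>0$, let $\alpha\in\mathbb{R}$ be irrational, and let $\theta\in\mathbb{R}$ with $\theta\notin \tfrac12+\alpha\mathbb{Z}+\mathbb{Z}$. Let $h_{\lambda,\alpha,\theta}$ be the Maryland operator on $\ell^2(\mathbb{Z})$, $$(h_{\lambda,\alpha,\theta}u)_n=u_{n+1}+u_{n-1}+\lambda\tan\big(\pi(\theta+n\alpha)\big)\,u_n ,$$ with its natural domain $\{u\in\ell^2(\mathbb{Z}) : h_{\lambda,\alpha,\theta}u\in\ell^2(\mathbb{Z})\}$. For $e\in\mathbb{R}$ put $$A(x)=\begin{pmatrix} e-\lambda\tan \pi x & -1\\ 1&0\end{pmatrix},\qquad A_n(x)=A(x+(n-1)\alpha)\cdots A(x+\alpha)A(x),$$ and let $$\gamma_\lambda(e)=\lim_{n\to\infty}\frac1n\int_0^1\ln\|A_n(x)\|\,dx$$ be the Lyapunov exponent, where $\|\cdot\|$ is the operator norm. Let $p_n/q_n$ be the continued fraction convergents of $\alpha$ and let $$\delta(\alpha,\theta)=\limsup_{n\to\infty}\frac{\ln\|q_n(\theta-\frac12)\|_{\mathbb{R}/\mathbb{Z}}+\ln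 q_{n+1}}{q_n}\in[-\infty,\infty],\qquad \|x\|_{\mathbb{R}/\mathbb{Z}}=\min_{\ell\in\mathbb{Z}}|x-\ell|,\quad \ln 0=-\infty .$$ If $e\in\mathbb{R}$ is an eigenvalue of $h_{\lambda,\alpha,\theta}$ with an exponentially decaying eigenfunction, i.e. there are $u\in\ell^2(\mathbb{Z})$, $u\neq0$, with $h_{\lambda,\alpha,\theta}u=eu$, and constants $C$ and $t>0$ with $|u_n|\le Ce^{-t|n|}$ for all $n\in\mathbb{Z}$, then $$\gamma_\lambda(e)>\delta(\alpha,\theta).$$ Moreover, there are at most two points $e\in\mathbb{R}$ with $\gamma_\lambda(e)=\delta(\alpha,\theta)$, and such an $e$ is never an eigenvalue of $h_{\lambda,\alpha,\theta}$ with an exponentially decaying eigenfunction. -/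

import Mathlib

noncomputable section

namespace Maryland

/-- The Hilbert space `ℓ²(ℤ)` of square-summable complex sequences. -/
abbrev EllTwo : Type := lp (fun _ : ℤ => ℂ) 2

/-- The formal action of the Maryland operator on an arbitrary sequence:
`(h u)_n = u_{n+1} + u_{n-1} + lam * tan (π (θ + n α)) * u_n`. -/
def action (lam α θ : ℝ) : (ℤ → ℂ) →ₗ[ℂ] (ℤ → ℂ) where
  toFun u n := u (n + 1) + u (n - 1) + ((lam * Real.tan (Real.pi * (θ + n * α)) : ℝ) : ℂ) * u n
  map_add' u v := by
    funext n
    simp only [Pi.add_apply]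
    ring
  map_smul' c u := by
    funext n
    simp only [Pi.smul_apply, smul_eq_mul, RingHom.id_apply]
    ring

/-- The Maryland operator `h_{lam,α,θ}` as an unbounded operator on `ℓ²(ℤ)`, with its natural
(maximal) domain `{u ∈ ℓ²(ℤ) : h u ∈ ℓ²(ℤ)}`. -/
def operator (lam α θ : ℝ) : EllTwo →ₗ.[ℂ] EllTwo where
  domain :=
    { carrier := {u | Memℓp (action lam α θ u) 2}
      zero_mem' := by
        change Memℓp (action lam α θ ((0 : EllTwo) : ℤ → ℂ)) 2
        rw [lp.coeFn_zero, map_zero]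
        exact zero_memℓp
      add_mem' := by
        intro u v hu hv
        change Memℓp (action lam α θ ((u + v : EllTwo) : ℤ → ℂ)) 2
        rw [lp.coeFn_add, map_add]
        exact Memℓp.add hu hv
      smul_mem' := by
        intro c u hu
        change Memℓp (action lam α θ ((c • u : EllTwo) : ℤ → ℂ)) 2
        rw [lp.coeFn_smul, map_smul]
        exact Memℓp.const_smul hu c }
  toFun :=
    { toFun := fun u => ⟨action lam α θ (u : EllTwo), u.2⟩
      map_add' := by
        intro u v
        apply lp.ext
        change action lam α θ (((u : EllTwo) + (v : EllTwo) : EllTwo) : ℤ → ℂ) = _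
        rw [lp.coeFn_add, map_add]
        rfl
      map_smul' := by
        intro c u
        apply lp.ext
        change action lam α θ ((c • (u : EllTwo) : EllTwo) : ℤ → ℂ) = _
        rw [lp.coeFn_smul, map_smul]
        rfl }

/-- `u` is an eigenfunction of `h_{lam,α,θ}` for the eigenvalue `e`. -/
def IsEigenfunction (lam α θ e : ℝ) (u : EllTwo) : Prop :=
  u ≠ 0 ∧ ∃ hu : u ∈ (operator lam α θ).domain, operator lam α θ ⟨u, hu⟩ = (e : ℂ) • u

/-- `|u_n| ≤ C e^{-t |n|}` for all `n`, with some constants `C` and `t > 0`. -/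
def ExpDecaying (u : ℤ → ℂ) : Prop :=
  ∃ C t : ℝ, 0 < t ∧ ∀ n : ℤ, ‖u n‖ ≤ C * Real.exp (-t * |(n : ℝ)|)

/-- `e` is an eigenvalue of `h_{lam,α,θ}` with an exponentially decaying eigenfunction. -/
def HasExpDecayingEigenfunction (lam α θ e : ℝ) : Prop :=
  ∃ u : EllTwo, IsEigenfunction lam α θ e u ∧ ExpDecaying u

/-- The one-step transfer matrix of `h u = e u`. -/
def transferMatrix (lam e x : ℝ) : Matrix (Fin 2) (Fin 2) ℝ :=
  !![e - lam * Real.tan (Real.pi * x), -1; 1, 0]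

/-- The `n`-step transfer matrix `A_n(x) = A(x + (n-1) α) ⋯ A(x + α) A(x)`. -/
def transferProduct (lam α e : ℝ) : ℕ → ℝ → Matrix (Fin 2) (Fin 2) ℝ
  | 0, _ => 1
  | n + 1, x => transferMatrix lam e (x + n * α) * transferProduct lam α e n x

open scoped Matrix.Norms.L2Operator in
/-- The Lyapunov exponent `γ_lam(e) = lim_n (1/n) ∫_𝕋 ln ‖A_n(x)‖ dx` of the Maryland cocycle,
where `‖·‖` is the operator norm for the Euclidean norm on `ℝ²`. -/
def lyapunovExponent (lam α e : ℝ) : ℝ :=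
  Filter.limUnder Filter.atTop (fun n : ℕ =>
    (1 / (n : ℝ)) * ∫ x in (0 : ℝ)..1, Real.log ‖transferProduct lam α e n x‖)

/-- The denominator `q_n` of the `n`-th continued fraction convergent of `α`. -/
def q (α : ℝ) (n : ℕ) : ℝ := (GenContFract.of α).dens n

/-- The index `δ(α, θ) ∈ [-∞, ∞]`,
`limsup_n (ln ‖q_n (θ - 1/2)‖_{ℝ/ℤ} + ln q_{n+1}) / q_n`, where `ln 0 = -∞`
(so the logarithm of the distance to `ℤ` is taken with values in `[-∞, ∞]`). -/
def delta (α θ : ℝ) : EReal :=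
  Filter.limsup (fun n : ℕ =>
    (ENNReal.log (ENNReal.ofReal ‖((q α n * (θ - 1 / 2) : ℝ) : UnitAddCircle)‖)
      + ((Real.log (q α (n + 1)) : ℝ) : EReal)) / ((q α n : ℝ) : EReal)) Filter.atTop

end Maryland

end

namespace Maryland

/-! ### Continued fraction denominators and the arithmetic criterion for `delta`. -/

section

open Filter Topology

/-! Let `ξ` be the root of `ξ + ξ⁻¹ = e - iλ` with `|ξ| > 1`. Two computations meet at this number.

The Lyapunov exponent is `log |ξ|` (`lyapunovExponent_eq`). After multiplication by `1 + e^{2πix}`,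
the transfer matrices are polynomials in `w = e^{2πix}`. For `|w| < 1` their Möbius action preserves
the lower half plane, so a suitable linear functional of the product has no zeros in the disc.
Jensen's formula then replaces the mean of its logarithm over the circle by the value at `w = 0`,
where the cocycle is a constant matrix with eigenvalues `ξ` and `ξ⁻¹`. Since `|ξ|` determines `e²`,
each level set of the exponent has at most two points.

For an exponentially decaying eigenfunction `u`, put `c_n = u_n / (1 + e^{2πi(θ+nα)})`. Its Fourier
series `f` is holomorphic on a strip and satisfies a first order equation
(`fourierSum_functional_equation`) whose two coefficients have equal modulus on the circle. Hence
`|f|` is invariant under the rotation by `α`, thus constant, and `f` has no real zeros. Taking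
logarithms gives a cohomological equation (`cohomological_equation`): the winding number `k` of `f`
yields `ξ / ξ̄ = e^{2πi(θ-1/2+kα)}`, and the `n`-th coefficient of `f'/f`, times `e^{2πinα} - 1`,
equals `2πi ξ⁻ⁿ (e^{2πin(θ-1/2+kα)} - 1)` for `n > 0`.

As `f'/f` is holomorphic near the real axis, its coefficients decay like `e^{-sn}` with some `s > 0`
(`logDeriv_coefficient_decay`). This gains a factor `e^{-sn}` over the threshold `|ξ|ⁿ`, and
evaluating at the denominators `q_n` makes the inequality strict (`delta_lt_of_norm_le`). -/

theorem exists_int_dens_nums (v : ℝ) (n : ℕ) :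
    ∃ a b : ℤ, (GenContFract.of v).nums n = a ∧ (GenContFract.of v).dens n = b := by
  -- The recurrence is of second order, so the induction carries two consecutive continuants.
  suffices h : ∀ n, (∃ a b : ℤ, ((GenContFract.of v).contsAux n).a = a ∧
      ((GenContFract.of v).contsAux n).b = b) ∧
      (∃ a b : ℤ, ((GenContFract.of v).contsAux (n + 1)).a = a ∧
      ((GenContFract.of v).contsAux (n + 1)).b = b) from (h n).2
  intro n
  induction n with
  | zero =>
    refine ⟨⟨1, 0, by simp, by simp⟩, ⟨⌊v⌋, 1, ?_, ?_⟩⟩ <;>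
      simp [GenContFract.first_contAux_eq_h_one]
  | succ n ih =>
    refine ⟨ih.2, ?_⟩
    obtain ⟨⟨a, b, ha, hb⟩, ⟨a', b', ha', hb'⟩⟩ := ih
    rcases hs : (GenContFract.of v).s.get? n with _ | gp
    · rw [GenContFract.contsAux_stable_step_of_terminated hs]
      exact ⟨a', b', ha', hb'⟩
    · obtain ⟨h1, z, hz⟩ := GenContFract.of_partNum_eq_one_and_exists_int_partDen_eq hs
      rw [GenContFract.contsAux_recurrence hs rfl rfl, h1, hz, ha, hb, ha', hb']
      exact ⟨z * a' + 1 * a, z * b' + 1 * b, by push_cast; rfl, by push_cast; rfl⟩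

theorem not_terminatedAt_of_irrational {α : ℝ} (hα : Irrational α) (n : ℕ) :
    ¬ (GenContFract.of α).TerminatedAt n := fun h => by
  obtain ⟨r, hr⟩ := (GenContFract.terminates_iff_rat α).1 ⟨n, h⟩
  exact hα ⟨r, hr.symm⟩

theorem fib_le_q {α : ℝ} (hα : Irrational α) (n : ℕ) : (Nat.fib (n + 1) : ℝ) ≤ q α n :=
  GenContFract.succ_nth_fib_le_of_nth_den (Or.inr (not_terminatedAt_of_irrational hα _))

theorem q_pos {α : ℝ} (hα : Irrational α) (n : ℕ) : 0 < q α n :=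
  lt_of_lt_of_le (by exact_mod_cast Nat.fib_pos.2 n.succ_pos) (fib_le_q hα n)

theorem tendsto_q {α : ℝ} (hα : Irrational α) : Tendsto (q α) atTop atTop := by
  refine tendsto_atTop_mono (fib_le_q hα) ?_
  refine tendsto_natCast_atTop_atTop.comp ?_
  refine (tendsto_add_atTop_iff_nat (f := Nat.fib) 1).2 ?_
  refine tendsto_atTop_mono' atTop ?_ tendsto_id
  filter_upwards [eventually_ge_atTop 5] with n hn using Nat.le_fib_self hn

theorem exists_nat_q {α : ℝ} (hα : Irrational α) (n : ℕ) : ∃ N : ℕ, 0 < N ∧ q α n = N := by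
  obtain ⟨a, b, -, hb⟩ := exists_int_dens_nums α n
  have hq : q α n = b := hb
  have h0 := q_pos hα n
  rw [hq] at h0
  have h0' : 0 < b := by exact_mod_cast h0
  refine ⟨b.toNat, by omega, ?_⟩
  rw [hq]
  exact_mod_cast (Int.toNat_of_nonneg h0'.le).symm

theorem unitAddCircle_norm_le (x : ℝ) (m : ℤ) : ‖(x : UnitAddCircle)‖ ≤ |x - m| := by
  rw [UnitAddCircle.norm_eq]
  exact round_le x m

theorem norm_q_mul_le {α : ℝ} (hα : Irrational α) (n : ℕ) :
    ‖((q α n * α : ℝ) : UnitAddCircle)‖ ≤ 1 / q α (n + 1) := by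
  obtain ⟨a, b, ha, hb⟩ := exists_int_dens_nums α n
  refine (unitAddCircle_norm_le _ a).trans ?_
  have h := GenContFract.abs_sub_convs_le (not_terminatedAt_of_irrational hα n)
  have h0 := q_pos hα n
  have h1 := q_pos hα (n + 1)
  rw [GenContFract.conv_eq_num_div_den, ha] at h
  change |α - a / q α n| ≤ 1 / (q α n * q α (n + 1)) at h
  have : q α n * α - a = q α n * (α - a / q α n) := by field_simp
  rw [this, abs_mul, abs_of_pos h0]
  calc q α n * |α - a / q α n| ≤ q α n * (1 / (q α n * q α (n + 1))) := by gcongr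
    _ = 1 / q α (n + 1) := by field_simp

/-- At a denominator `q_n` the factor `‖q_n α‖` is at most `1 / q_{n+1}`, which cancels the term `ln
q_{n+1}` in `delta`. Removing the shift `kα` costs only `|k| ‖q_n α‖`, of the same order. -/
theorem delta_lt_of_norm_le {α θ γ t C : ℝ} (hα : Irrational α) (hγ : 0 < γ) (ht : 0 < t) (k : ℤ)
    (h : ∀ n : ℕ, 0 < n → ‖((n * (θ - 1 / 2 + k * α) : ℝ) : UnitAddCircle)‖ ≤
      C * Real.exp ((γ - t) * n) * ‖((n * α : ℝ) : UnitAddCircle)‖) :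
    delta α θ < (γ : EReal) := by
  -- Truncation at `0` lets `exp (s * N) ≥ 1` absorb the bounded term coming from `k`; positivity of
  -- `γ` keeps `s < γ`.
  set s : ℝ := max (γ - t) 0 with hs
  set M : ℝ := |C| + |(k : ℝ)| + 1 with hM
  have hMpos : 0 < M := by positivity
  have key : ∀ n : ℕ, ‖((q α n * (θ - 1 / 2) : ℝ) : UnitAddCircle)‖ * q α (n + 1) ≤
      M * Real.exp (s * q α n) := by
    intro n
    obtain ⟨N, hN, hqN⟩ := exists_nat_q hα n
    have h1 := h N hN
    have h2 := norm_q_mul_le hα n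
    have hq1 := q_pos hα (n + 1)
    rw [hqN] at h2 ⊢
    have hsplit : ((N * (θ - 1 / 2) : ℝ) : UnitAddCircle) =
        ((N * (θ - 1 / 2 + k * α) : ℝ) : UnitAddCircle) - k • ((N * α : ℝ) : UnitAddCircle) := by
      rw [← AddCircle.coe_zsmul, ← AddCircle.coe_sub]
      congr 1
      simp only [zsmul_eq_mul]
      ring
    have h3 : ‖k • ((N * α : ℝ) : UnitAddCircle)‖ ≤ |(k : ℝ)| * ‖((N * α : ℝ) : UnitAddCircle)‖ := by
      refine (norm_zsmul_le _ _).trans_eq ?_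
      rw [Int.norm_eq_abs]
    have hle : ‖((N * (θ - 1 / 2) : ℝ) : UnitAddCircle)‖ ≤
        (|C| * Real.exp (s * N) + |(k : ℝ)|) * (1 / q α (n + 1)) := by
      rw [hsplit]
      refine (norm_sub_le _ _).trans ((add_le_add h1 h3).trans ?_)
      rw [← add_mul]
      have : C * Real.exp ((γ - t) * N) ≤ |C| * Real.exp (s * N) := by
        gcongr
        · exact le_abs_self C
        · exact le_max_left _ _
      gcongr
    have hexp : 1 ≤ Real.exp (s * N) := Real.one_le_exp (by positivity)
    calc _ ≤ (|C| * Real.exp (s * N) + |(k : ℝ)|) * (1 / q α (n + 1)) * q α (n + 1) := by gcongr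
      _ = |C| * Real.exp (s * N) + |(k : ℝ)| := by field_simp
      _ ≤ |C| * Real.exp (s * N) + (|(k : ℝ)| + 1) * Real.exp (s * N) := by
        gcongr
        nlinarith [abs_nonneg (k : ℝ)]
      _ = M * Real.exp (s * N) := by rw [hM]; ring
  have hsγ : s < γ := max_lt (by linarith) hγ
  obtain ⟨r, hr1, hr2⟩ := exists_between hsγ
  refine lt_of_le_of_lt (b := (r : EReal)) ?_ (by exact_mod_cast hr2)
  refine limsup_le_of_le (by isBoundedDefault) ?_
  have hlim : Tendsto (fun n => (r - s) * q α n) atTop atTop :=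
    (tendsto_q hα).const_mul_atTop (by linarith)
  filter_upwards [hlim.eventually_ge_atTop (Real.log M)] with n hn
  have hq0 := q_pos hα n
  have hq1 := q_pos hα (n + 1)
  rw [EReal.div_le_iff_le_mul (by exact_mod_cast hq0) (EReal.coe_ne_top _), ENNReal.log_ofReal]
  split_ifs with h0
  -- If the distance to `ℤ` vanishes, the logarithm is `⊥` and the bound is trivial.
  · simp
  · rw [not_le] at h0
    norm_cast
    rw [← Real.log_mul h0.ne' hq1.ne']
    have := Real.log_le_log (by positivity) (key n)
    rw [Real.log_mul hMpos.ne' (Real.exp_pos _).ne', Real.log_exp] at this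
    linarith

end

/-! ### Characters, Jensen's formula, and the complexified cocycle in the unit disc. -/

section

open Filter Topology Polynomial MeasureTheory

/-- The character `x ↦ e^{2πix}` on `ℂ`. -/
noncomputable def expChar (x : ℂ) : ℂ := Complex.exp (2 * Real.pi * Complex.I * x)

theorem expChar_add (x y : ℂ) : expChar (x + y) = expChar x * expChar y := by
  rw [expChar, mul_add, Complex.exp_add]; rfl

theorem expChar_ne_zero (x : ℂ) : expChar x ≠ 0 := Complex.exp_ne_zero _

theorem expChar_zero : expChar 0 = 1 := by simp [expChar]

theorem expChar_int (n : ℤ) : expChar n = 1 := by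
  rw [expChar, Complex.exp_eq_one_iff]
  exact ⟨n, by ring⟩

theorem expChar_neg (x : ℂ) : expChar (-x) = (expChar x)⁻¹ := by
  rw [expChar, mul_neg, Complex.exp_neg]; rfl

theorem norm_expChar (x : ℂ) : ‖expChar x‖ = Real.exp (-2 * Real.pi * x.im) := by
  rw [expChar, Complex.norm_exp]
  congr 1
  simp

theorem norm_expChar_ofReal (x : ℝ) : ‖expChar x‖ = 1 := by
  simp [norm_expChar]

theorem expChar_int_mul (n : ℤ) (x : ℂ) : expChar (n * x) = expChar x ^ n := by
  rw [expChar, expChar, ← Complex.exp_int_mul]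
  congr 1; ring

theorem one_add_expChar (x : ℂ) :
    1 + expChar x = 2 * expChar (x / 2) * Complex.cos (Real.pi * x) := by
  have h1 : expChar x = Complex.exp (Real.pi * x * Complex.I) * Complex.exp (Real.pi * x * Complex.I) := by
    rw [← Complex.exp_add, expChar]; congr 1; ring
  have h2 : expChar (x / 2) = Complex.exp (Real.pi * x * Complex.I) := by
    rw [expChar]; congr 1; ring
  have h3 : Complex.exp (Real.pi * x * Complex.I) * Complex.exp (-(Real.pi * x) * Complex.I) = 1 := by
    rw [← Complex.exp_add]; simp
  rw [Complex.cos, h1, h2]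
  linear_combination -h3

theorem expChar_sub_one (x : ℂ) :
    expChar x - 1 = 2 * Complex.I * expChar (x / 2) * Complex.sin (Real.pi * x) := by
  have h1 : expChar x = Complex.exp (Real.pi * x * Complex.I) * Complex.exp (Real.pi * x * Complex.I) := by
    rw [← Complex.exp_add, expChar]; congr 1; ring
  have h2 : expChar (x / 2) = Complex.exp (Real.pi * x * Complex.I) := by
    rw [expChar]; congr 1; ring
  have h3 : Complex.exp (Real.pi * x * Complex.I) * Complex.exp (-(Real.pi * x) * Complex.I) = 1 := by
    rw [← Complex.exp_add]; simp
  rw [Complex.sin, h1, h2]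
  linear_combination (Complex.exp (Real.pi * x * Complex.I) * Complex.exp (Real.pi * x * Complex.I)
    - Complex.exp (Real.pi * x * Complex.I) * Complex.exp (-(Real.pi * x) * Complex.I)) * Complex.I_sq
    + h3

theorem one_add_expChar_mul_tan {x : ℝ} (h : Real.cos (Real.pi * x) ≠ 0) :
    (1 + expChar x) * (Real.tan (Real.pi * x) : ℝ) = -Complex.I * (expChar x - 1) := by
  have h' : Complex.cos (Real.pi * x) ≠ 0 := by
    rw [← Complex.ofReal_mul, ← Complex.ofReal_cos]; exact_mod_cast h
  rw [one_add_expChar, expChar_sub_one, Real.tan_eq_sin_div_cos]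
  push_cast
  generalize Complex.cos (Real.pi * x) = c at h'
  generalize Complex.sin (Real.pi * x) = s
  have hc : c * (s / c) = s := mul_div_cancel₀ s h'
  linear_combination 2 * expChar (x / 2) * hc + 2 * expChar (x / 2) * s * Complex.I_sq

theorem one_add_expChar_ne_zero {x : ℝ} (h : Real.cos (Real.pi * x) ≠ 0) : 1 + expChar x ≠ 0 := by
  have h' : Complex.cos (Real.pi * x) ≠ 0 := by
    rw [← Complex.ofReal_mul, ← Complex.ofReal_cos]; exact_mod_cast h
  rw [one_add_expChar]
  exact mul_ne_zero (mul_ne_zero two_ne_zero (expChar_ne_zero _)) h'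

/-- The roots of `η² - zη + 1` are mutually inverse; on the unit circle `η + η⁻¹ = 2 Re η` would be
real, so one of them lies outside. -/
theorem exists_add_inv_eq {z : ℂ} (hz : z.im ≠ 0) : ∃ ξ : ℂ, 1 < ‖ξ‖ ∧ ξ + ξ⁻¹ = z := by
  obtain ⟨s, hs⟩ := IsAlgClosed.exists_pow_nat_eq (z ^ 2 - 4) (n := 2) two_pos
  have hprod : ((z + s) / 2) * ((z - s) / 2) = 1 := by linear_combination -hs / 4
  have h0 : (z + s) / 2 ≠ 0 := left_ne_zero_of_mul_eq_one hprod
  have hinv : ((z + s) / 2)⁻¹ = (z - s) / 2 := inv_eq_of_mul_eq_one_right hprod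
  set η := (z + s) / 2 with hη
  have hsum : η + η⁻¹ = z := by rw [hinv, hη]; ring
  rcases lt_trichotomy ‖η‖ 1 with h | h | h
  · refine ⟨η⁻¹, ?_, by rw [inv_inv, add_comm, hsum]⟩
    rw [norm_inv]
    exact (one_lt_inv₀ (norm_pos_iff.2 h0)).2 h
  · exfalso
    apply hz
    rw [← hsum, Complex.inv_eq_conj h]
    simp
  · exact ⟨η, h, hsum⟩

/-- The `log` integral over the circle of a polynomial without zeros in the open unit disc. -/
theorem integral_log_norm_eval_expChar {p : ℂ[X]} (hp : ∀ w : ℂ, ‖w‖ < 1 → p.eval w ≠ 0) :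
    IntervalIntegrable (fun x : ℝ => Real.log ‖p.eval (expChar x)‖) volume 0 1 ∧
    ∫ x in (0 : ℝ)..1, Real.log ‖p.eval (expChar x)‖ = Real.log ‖p.eval 0‖ := by
  have hcm : ∀ x : ℝ, expChar x = circleMap 0 1 ((2 * Real.pi) * x) := by
    intro x
    rw [expChar, circleMap]
    push_cast
    rw [zero_add, one_mul]
    congr 1; ring
  simp only [hcm]
  constructor
  · have := (p.intervalIntegrable_mahlerMeasure).comp_mul_left (c := 2 * Real.pi)
    simpa [Real.pi_ne_zero] using this
  · rw [intervalIntegral.integral_comp_mul_left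
      (fun y => Real.log ‖p.eval (circleMap 0 1 y)‖) (by positivity : (2 * Real.pi) ≠ 0)]
    have hdef : p.logMahlerMeasure = (2 * Real.pi)⁻¹ •
        ∫ y in (0 : ℝ)..2 * Real.pi, Real.log ‖p.eval (circleMap 0 1 y)‖ := rfl
    rw [mul_zero, mul_one, ← hdef, logMahlerMeasure_eq_log_leadingCoeff_add_sum_log_roots]
    have hp0 : p ≠ 0 := by
      rintro rfl
      exact hp 0 (by simp) (by simp)
    -- With no root in the open disc, `posLog` agrees with `log` at every root, and the root formula
    -- for the Mahler measure collapses to the constant term.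
    have hroot : ∀ a ∈ p.roots, 1 ≤ ‖a‖ := by
      intro a ha
      by_contra hlt
      exact hp a (not_le.1 hlt) (isRoot_of_mem_roots ha)
    have heval : p.eval 0 = p.leadingCoeff * (p.roots.map (fun a => -a)).prod := by
      conv_lhs => rw [(IsAlgClosed.splits p).eq_prod_roots]
      rw [eval_mul, eval_C, eval_multiset_prod, Multiset.map_map]
      simp
    have hn : ‖(p.roots.map (fun a => -a)).prod‖ = (p.roots.map (fun a => ‖a‖)).prod := by
      induction p.roots using Multiset.induction_on with
      | empty => simp
      | cons a m ih => simp only [Multiset.map_cons, Multiset.prod_cons, norm_mul, norm_neg, ih]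
    have hlog : Real.log (p.roots.map (fun a => ‖a‖)).prod =
        (p.roots.map (fun a => Real.posLog ‖a‖)).sum := by
      rw [Real.log_multiset_prod, Multiset.map_map]
      · congr 1
        refine Multiset.map_congr rfl fun a ha => ?_
        have h1 : 1 ≤ |‖a‖| := by rw [abs_norm]; exact hroot a ha
        exact (Real.posLog_eq_log h1).symm
      · intro y hy
        obtain ⟨a, ha, rfl⟩ := Multiset.mem_map.1 hy
        exact (zero_lt_one.trans_le (hroot a ha)).ne'
    have hpne : ‖(p.roots.map (fun a => -a)).prod‖ ≠ 0 := by
      intro h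
      apply hp 0 (by simp)
      rw [heval, norm_eq_zero.1 h, mul_zero]
    rw [heval, norm_mul, Real.log_mul (by simpa using hp0) hpne, hn, hlog]

/-- Numerators of the Möbius orbit of `-i` under the complexified transfer matrices, with the
denominators `1 + e^{2πi(x + jα)}` cleared, as polynomials in `e^{2πix}`. -/
noncomputable def orbit (lam α e : ℝ) : ℕ → ℂ[X] × ℂ[X]
  | 0 => (C (-Complex.I), 1)
  | n + 1 =>
    ((C (e : ℂ) * (1 + C (expChar (n * α : ℝ)) * X)
      + C (Complex.I * lam) * (C (expChar (n * α : ℝ)) * X - 1)) * (orbit lam α e n).1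
      - (1 + C (expChar (n * α : ℝ)) * X) * (orbit lam α e n).2,
      (1 + C (expChar (n * α : ℝ)) * X) * (orbit lam α e n).1)

/-- The pairing of the orbit of `(-i, 1)` with the covector `(1, -i)`: it detects whether the Möbius
orbit of `-i` hits `i`. -/
noncomputable def orbitSum (lam α e : ℝ) (n : ℕ) : ℂ[X] :=
  (orbit lam α e n).1 - C Complex.I * (orbit lam α e n).2

/-- The quotient of the two components stays in the lower half plane: inside the disc the continued
tangent has positive imaginary part, so `e - λ tan` points downwards, and `y ↦ -1/y` preserves the
half plane. The form with a conjugate avoids division. -/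
theorem im_orbit_neg {lam : ℝ} (hlam : 0 < lam) (α e : ℝ) {w : ℂ} (hw : ‖w‖ < 1) (n : ℕ) :
    (((orbit lam α e n).1.eval w) * (starRingEnd ℂ) ((orbit lam α e n).2.eval w)).im < 0 := by
  induction n with
  | zero => simp [orbit]
  | succ n ih =>
    simp only [orbit, eval_sub, eval_mul, eval_add, eval_C, eval_one, eval_X]
    set v : ℂ := expChar (n * α : ℝ) * w with hv
    set y₁ := (orbit lam α e n).1.eval w
    set y₂ := (orbit lam α e n).2.eval w
    have hvn : ‖v‖ < 1 := by rw [hv, norm_mul, norm_expChar_ofReal, one_mul]; exact hw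
    have hvsq : v.re ^ 2 + v.im ^ 2 < 1 := by
      have := Complex.sq_norm v
      rw [Complex.normSq_apply] at this
      nlinarith [norm_nonneg v]
    have hv1 : 0 < (1 + v.re) ^ 2 + v.im ^ 2 := by
      nlinarith [sq_nonneg (1 + v.re), sq_nonneg v.im]
    have hid : (((e * (1 + v) + Complex.I * lam * (v - 1)) * y₁ - (1 + v) * y₂) *
        (starRingEnd ℂ) ((1 + v) * y₁)).im =
        lam * (v.re ^ 2 + v.im ^ 2 - 1) * (y₁.re ^ 2 + y₁.im ^ 2) +
        ((1 + v.re) ^ 2 + v.im ^ 2) * (y₁ * (starRingEnd ℂ) y₂).im := by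
      simp [Complex.mul_im, Complex.mul_re]
      ring
    rw [hid]
    have h1 : lam * (v.re ^ 2 + v.im ^ 2 - 1) * (y₁.re ^ 2 + y₁.im ^ 2) ≤ 0 :=
      mul_nonpos_of_nonpos_of_nonneg
        (mul_nonpos_of_nonneg_of_nonpos hlam.le (by linarith)) (by positivity)
    have h2 := mul_neg_of_pos_of_neg hv1 ih
    linarith

theorem orbitSum_eval_ne_zero {lam : ℝ} (hlam : 0 < lam) (α e : ℝ) (n : ℕ) {w : ℂ}
    (hw : ‖w‖ < 1) : (orbitSum lam α e n).eval w ≠ 0 := by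
  intro h
  have h1 := im_orbit_neg hlam α e hw n
  rw [orbitSum, eval_sub, eval_mul, eval_C, sub_eq_zero] at h
  rw [h, mul_assoc, Complex.mul_conj] at h1
  simp at h1
  exact absurd h1 (not_lt.2 (Complex.normSq_nonneg _))

/-- The linear functional `(b - c) - i (a + d)` of a matrix `(a b; c d)`. -/
def skewTrace (A : Matrix (Fin 2) (Fin 2) ℝ) : ℂ :=
  (A 0 1 - A 1 0 : ℝ) - Complex.I * (A 0 0 + A 1 1 : ℝ)

theorem orbit_eval_expChar (lam α e : ℝ) {x : ℝ} (n : ℕ)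
    (hx : ∀ j : ℕ, Real.cos (Real.pi * (x + j * α)) ≠ 0) :
    (orbit lam α e n).1.eval (expChar x) = (∏ j ∈ Finset.range n, (1 + expChar (x + j * α : ℝ))) *
      (-Complex.I * (transferProduct lam α e n x 0 0 : ℝ) + (transferProduct lam α e n x 0 1 : ℝ)) ∧
    (orbit lam α e n).2.eval (expChar x) = (∏ j ∈ Finset.range n, (1 + expChar (x + j * α : ℝ))) *
      (-Complex.I * (transferProduct lam α e n x 1 0 : ℝ) + (transferProduct lam α e n x 1 1 : ℝ)) := by
  induction n with
  | zero => simp [orbit, transferProduct]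
  | succ n ih =>
    have ht := one_add_expChar_mul_tan (hx n)
    have hexp : expChar (n * α : ℝ) * expChar x = expChar (x + n * α : ℝ) := by
      rw [← expChar_add]; congr 1; push_cast; ring
    simp only [orbit, eval_sub, eval_mul, eval_add, eval_C, eval_one, eval_X, ih.1, ih.2, hexp,
      transferProduct, transferMatrix, Matrix.mul_apply, Fin.sum_univ_two, Finset.prod_range_succ,
      Matrix.cons_val_zero, Matrix.cons_val_one, Matrix.of_apply, Matrix.cons_val', Matrix.cons_val_fin_one]
    set P := ∏ j ∈ Finset.range n, (1 + expChar (x + j * α : ℝ))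
    set w := expChar (x + n * α : ℝ)
    set T := transferProduct lam α e n x
    constructor
    · push_cast
      push_cast at ht
      linear_combination (P * lam * (-Complex.I * T 0 0 + T 0 1)) * ht
    · push_cast
      ring

theorem orbitSum_eval_expChar (lam α e : ℝ) {x : ℝ} (n : ℕ)
    (hx : ∀ j : ℕ, Real.cos (Real.pi * (x + j * α)) ≠ 0) :
    (orbitSum lam α e n).eval (expChar x) =
      (∏ j ∈ Finset.range n, (1 + expChar (x + j * α : ℝ))) *
        skewTrace (transferProduct lam α e n x) := by
  obtain ⟨h1, h2⟩ := orbit_eval_expChar lam α e n hx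
  rw [orbitSum, eval_sub, eval_mul, eval_C, h1, h2, skewTrace]
  rw [Complex.ofReal_sub, Complex.ofReal_add]
  linear_combination ((∏ j ∈ Finset.range n, (1 + expChar (x + j * α : ℝ))) *
    (transferProduct lam α e n x 1 0 : ℂ)) * Complex.I_sq

theorem det_transferProduct (lam α e : ℝ) (n : ℕ) (x : ℝ) :
    (transferProduct lam α e n x).det = 1 := by
  induction n with
  | zero => simp [transferProduct]
  | succ n ih => rw [transferProduct, Matrix.det_mul, ih]; simp [transferMatrix, Matrix.det_fin_two]

/-- When the determinant is `1` this is the square of the sum of the singular values, which makes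
`skewTrace` comparable with the operator norm. -/
theorem norm_skewTrace_sq (A : Matrix (Fin 2) (Fin 2) ℝ) :
    ‖skewTrace A‖ ^ 2 = A 0 0 ^ 2 + A 0 1 ^ 2 + A 1 0 ^ 2 + A 1 1 ^ 2 + 2 * A.det := by
  rw [Complex.sq_norm, Complex.normSq_apply, skewTrace, Matrix.det_fin_two]
  simp
  ring

open scoped Matrix.Norms.L2Operator in
theorem norm_le_norm_skewTrace {A : Matrix (Fin 2) (Fin 2) ℝ} (hA : A.det = 1) :
    ‖A‖ ≤ ‖skewTrace A‖ := by
  rw [Matrix.l2_opNorm_def]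
  refine ContinuousLinearMap.opNorm_le_bound _ (norm_nonneg _) fun v => ?_
  refine le_of_sq_le_sq ?_ (by positivity)
  rw [mul_pow, norm_skewTrace_sq, hA, EuclideanSpace.norm_sq_eq, EuclideanSpace.norm_sq_eq]
  simp [Fin.sum_univ_two, Matrix.toLpLin_apply]
  -- Cauchy–Schwarz for each row, in Lagrange's form; the squares of the entries of `v` account for
  -- the surplus `2 |v|²`.
  nlinarith [sq_nonneg (A 0 0 * v 1 - A 0 1 * v 0), sq_nonneg (A 1 0 * v 1 - A 1 1 * v 0),
    sq_nonneg (v 0), sq_nonneg (v 1)]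

open scoped Matrix.Norms.L2Operator in
theorem abs_entry_le_norm (A : Matrix (Fin 2) (Fin 2) ℝ) (i j : Fin 2) : |A i j| ≤ ‖A‖ := by
  have h := Matrix.l2_opNorm_mulVec A (EuclideanSpace.single j (1 : ℝ))
  rw [PiLp.norm_single, norm_one, mul_one] at h
  refine le_trans ?_ h
  have := PiLp.norm_apply_le ((EuclideanSpace.equiv (Fin 2) ℝ).symm (A.mulVec (EuclideanSpace.single j (1 : ℝ)))) i
  simpa using this

open scoped Matrix.Norms.L2Operator in
theorem norm_skewTrace_le (A : Matrix (Fin 2) (Fin 2) ℝ) : ‖skewTrace A‖ ≤ 4 * ‖A‖ := by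
  have h := abs_entry_le_norm A
  rw [skewTrace]
  refine (norm_sub_le _ _).trans ?_
  rw [norm_mul, Complex.norm_I, one_mul, Complex.norm_real, Complex.norm_real, Real.norm_eq_abs, Real.norm_eq_abs]
  have h1 := abs_sub (A 0 1) (A 1 0)
  have h2 := abs_add_le (A 0 0) (A 1 1)
  linarith [h 0 0, h 0 1, h 1 0, h 1 1]

end

/-! ### Computation of the Lyapunov exponent and its level sets. -/

section

open Filter Topology Polynomial MeasureTheory

theorem ae_cos_ne_zero (α : ℝ) : ∀ᵐ x : ℝ, ∀ j : ℕ, Real.cos (Real.pi * (x + j * α)) ≠ 0 := by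
  refine ae_all_iff.2 fun j => ?_
  have hc : (Set.range fun k : ℤ => (2 * (k : ℝ) + 1) / 2 - j * α).Countable :=
    Set.countable_range _
  filter_upwards [hc.ae_notMem volume] with x hx h0
  obtain ⟨k, hk⟩ := Real.cos_eq_zero_iff.1 h0
  refine hx ⟨k, ?_⟩
  have hpi := Real.pi_pos.ne'
  have : Real.pi * (x + j * α) = Real.pi * ((2 * k + 1) / 2) := by rw [hk]; ring
  have := mul_left_cancel₀ hpi this
  change (2 * (k : ℝ) + 1) / 2 - j * α = x
  linarith

theorem measurable_transferProduct (lam α e : ℝ) (n : ℕ) (i j : Fin 2) :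
    Measurable fun x => transferProduct lam α e n x i j := by
  induction n generalizing i j with
  | zero => exact measurable_const
  | succ n ih =>
    have htan : Measurable fun x : ℝ => Real.tan (Real.pi * (x + n * α)) := by
      simp only [Real.tan_eq_sin_div_cos]
      fun_prop
    have hT : ∀ k : Fin 2, Measurable fun x => transferMatrix lam e (x + n * α) i k := by
      intro k
      fin_cases i <;> fin_cases k <;> simp [transferMatrix]
      exact (htan.const_mul lam).const_sub e
    simp only [transferProduct, Matrix.mul_apply, Fin.sum_univ_two]
    exact ((hT 0).mul (ih 0 j)).add ((hT 1).mul (ih 1 j))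

open scoped Matrix.Norms.L2Operator in
theorem measurable_norm_transferProduct (lam α e : ℝ) (n : ℕ) :
    Measurable fun x => ‖transferProduct lam α e n x‖ := by
  have hcont : Continuous fun f : Fin 2 → Fin 2 → ℝ => ‖(Matrix.of f : Matrix (Fin 2) (Fin 2) ℝ)‖ :=
    continuous_norm (E := Matrix (Fin 2) (Fin 2) ℝ)
  refine hcont.measurable.comp (g := fun f : Fin 2 → Fin 2 → ℝ =>
    ‖(Matrix.of f : Matrix (Fin 2) (Fin 2) ℝ)‖) (f := fun x => transferProduct lam α e n x) ?_
  exact measurable_pi_lambda _ fun i => measurable_pi_lambda _ fun j =>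
    measurable_transferProduct lam α e n i j

theorem integral_log_norm_one_add_expChar (β : ℝ) :
    IntervalIntegrable (fun x : ℝ => Real.log ‖1 + expChar (x + β : ℝ)‖) volume 0 1 ∧
    ∫ x in (0 : ℝ)..1, Real.log ‖1 + expChar (x + β : ℝ)‖ = 0 := by
  have heq : ∀ x : ℝ, 1 + expChar (x + β : ℝ) =
      (1 + C (expChar β) * X : ℂ[X]).eval (expChar x) := by
    intro x
    simp only [eval_add, eval_one, eval_mul, eval_C, eval_X]
    rw [← expChar_add, add_comm x β]
    push_cast; rfl
  simp only [heq]
  have h := integral_log_norm_eval_expChar (p := (1 + C (expChar β) * X : ℂ[X])) ?_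
  · simpa using h
  · intro w hw h0
    simp only [eval_add, eval_one, eval_mul, eval_C, eval_X] at h0
    have h1 : expChar β * w = -1 := by linear_combination h0
    have h2 := congrArg norm h1
    rw [norm_mul, norm_expChar_ofReal, one_mul, norm_neg, norm_one] at h2
    linarith

/-- Jensen's formula applies to `orbitSum`, which has no zeros in the disc. The cleared denominators
`1 + e^{2πi(x+jα)}` cost nothing, each having logarithmic mean zero. -/
theorem integral_log_norm_skewTrace {lam : ℝ} (hlam : 0 < lam) (α e : ℝ) (n : ℕ) :
    IntervalIntegrable (fun x : ℝ => Real.log ‖skewTrace (transferProduct lam α e n x)‖)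
      volume 0 1 ∧
    ∫ x in (0 : ℝ)..1, Real.log ‖skewTrace (transferProduct lam α e n x)‖ =
      Real.log ‖(orbitSum lam α e n).eval 0‖ := by
  obtain ⟨hi, hv⟩ := integral_log_norm_eval_expChar
    (fun w hw => orbitSum_eval_ne_zero hlam α e n (w := w) hw)
  have hprod : ∀ j : ℕ, IntervalIntegrable
      (fun x : ℝ => Real.log ‖1 + expChar (x + j * α : ℝ)‖) volume 0 1 :=
    fun j => (integral_log_norm_one_add_expChar (j * α)).1
  have hsum : IntervalIntegrable
      (fun x : ℝ => ∑ j ∈ Finset.range n, Real.log ‖1 + expChar (x + j * α : ℝ)‖) volume 0 1 := by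
    have h := IntervalIntegrable.sum (Finset.range n) fun j _ => hprod j
    rwa [Finset.sum_fn] at h
  have hae : ∀ᵐ x : ℝ, Real.log ‖skewTrace (transferProduct lam α e n x)‖ =
      Real.log ‖(orbitSum lam α e n).eval (expChar x)‖ -
        ∑ j ∈ Finset.range n, Real.log ‖1 + expChar (x + j * α : ℝ)‖ := by
    filter_upwards [ae_cos_ne_zero α] with x hx
    have hne : ∀ j ∈ Finset.range n, ‖1 + expChar (x + j * α : ℝ)‖ ≠ 0 := fun j _ =>
      norm_ne_zero_iff.2 (one_add_expChar_ne_zero (hx j))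
    have hs : ‖skewTrace (transferProduct lam α e n x)‖ ≠ 0 := by
      have h := norm_skewTrace_sq (transferProduct lam α e n x)
      rw [det_transferProduct] at h
      intro h0
      rw [h0] at h
      nlinarith [sq_nonneg (transferProduct lam α e n x 0 0),
        sq_nonneg (transferProduct lam α e n x 0 1), sq_nonneg (transferProduct lam α e n x 1 0),
        sq_nonneg (transferProduct lam α e n x 1 1)]
    rw [orbitSum_eval_expChar lam α e n hx, norm_mul, norm_prod,
      Real.log_mul (Finset.prod_ne_zero_iff.2 hne) hs, Real.log_prod hne]
    ring
  constructor
  · exact (hi.sub hsum).congr_ae (ae_restrict_of_ae (hae.mono fun x hx => hx.symm))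
  · rw [intervalIntegral.integral_congr_ae (hae.mono fun x hx _ => hx),
      intervalIntegral.integral_sub hi hsum, hv,
      intervalIntegral.integral_finsetSum fun j _ => hprod j,
      Finset.sum_eq_zero fun (j : ℕ) _ => (integral_log_norm_one_add_expChar (j * α)).2, sub_zero]

open scoped Matrix.Norms.L2Operator in
theorem integral_log_norm_transferProduct_bounds {lam : ℝ} (hlam : 0 < lam) (α e : ℝ) (n : ℕ) :
    Real.log ‖(orbitSum lam α e n).eval 0‖ - Real.log 4 ≤
      ∫ x in (0 : ℝ)..1, Real.log ‖transferProduct lam α e n x‖ ∧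
    ∫ x in (0 : ℝ)..1, Real.log ‖transferProduct lam α e n x‖ ≤
      Real.log ‖(orbitSum lam α e n).eval 0‖ := by
  obtain ⟨hi, hv⟩ := integral_log_norm_skewTrace hlam α e n
  have hpos : ∀ x, 0 < ‖transferProduct lam α e n x‖ := by
    intro x
    refine norm_pos_iff.2 fun h => ?_
    have := det_transferProduct lam α e n x
    rw [h] at this
    simp at this
  have hupper : ∀ x, Real.log ‖transferProduct lam α e n x‖ ≤
      Real.log ‖skewTrace (transferProduct lam α e n x)‖ := fun x =>
    Real.log_le_log (hpos x) (norm_le_norm_skewTrace (det_transferProduct lam α e n x))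
  have hlower : ∀ x, Real.log ‖skewTrace (transferProduct lam α e n x)‖ - Real.log 4 ≤
      Real.log ‖transferProduct lam α e n x‖ := fun x => by
    have h1 := norm_le_norm_skewTrace (det_transferProduct lam α e n x)
    have h2 := Real.log_le_log ((hpos x).trans_le h1) (norm_skewTrace_le _)
    rw [Real.log_mul (by norm_num) (hpos x).ne'] at h2
    linarith
  have hlow_i : IntervalIntegrable (fun x : ℝ =>
      Real.log ‖skewTrace (transferProduct lam α e n x)‖ - Real.log 4) volume 0 1 :=
    hi.sub intervalIntegrable_const
  have hint : IntervalIntegrable (fun x => Real.log ‖transferProduct lam α e n x‖) volume 0 1 := by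
    refine (hlow_i.norm.add hi.norm).mono_fun
      ((measurable_norm_transferProduct lam α e n).log.aestronglyMeasurable) ?_
    refine ae_of_all _ fun x => ?_
    simp only [Real.norm_eq_abs]
    rw [abs_of_nonneg (add_nonneg (abs_nonneg (_ : ℝ)) (abs_nonneg (_ : ℝ)))]
    refine abs_le.2 ⟨?_, ?_⟩
    · linarith [hlower x, neg_abs_le (Real.log ‖skewTrace (transferProduct lam α e n x)‖ - Real.log 4),
        abs_nonneg (Real.log ‖skewTrace (transferProduct lam α e n x)‖)]
    · linarith [hupper x, le_abs_self (Real.log ‖skewTrace (transferProduct lam α e n x)‖),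
        abs_nonneg (Real.log ‖skewTrace (transferProduct lam α e n x)‖ - Real.log 4)]
  constructor
  · have h := intervalIntegral.integral_mono_on zero_le_one hlow_i hint fun x _ => hlower x
    rw [intervalIntegral.integral_sub hi intervalIntegrable_const, hv] at h
    simpa using h
  · rw [← hv]
    exact intervalIntegral.integral_mono_on zero_le_one hint hi fun x _ => hupper x

theorem exists_orbitSum_eval_zero {lam e : ℝ} (α : ℝ) {ξ : ℂ} (hξ : 1 < ‖ξ‖)
    (hsum : ξ + ξ⁻¹ = e - Complex.I * lam) :
    ∃ a b : ℂ, a ≠ 0 ∧ ∀ n, (orbitSum lam α e n).eval 0 = a * ξ ^ n + b * ξ⁻¹ ^ n := by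
  have h0 : ξ ≠ 0 := norm_pos_iff.1 (zero_lt_one.trans hξ)
  have hI : ξ - Complex.I ≠ 0 := by
    intro h
    rw [sub_eq_zero.1 h, Complex.norm_I] at hξ
    exact lt_irrefl _ hξ
  have hd : ξ - ξ⁻¹ ≠ 0 := by
    intro h
    have h1 := congrArg norm (sub_eq_zero.1 h)
    rw [norm_inv] at h1
    linarith [inv_lt_one_of_one_lt₀ hξ]
  -- Coefficients of `(-i, 1)` in the eigenvectors `(1, ξ⁻¹)` and `(1, ξ)` of the constant matrix at
  -- `w = 0`. The growing one is nonzero because `ξ ≠ i`.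
  set a := -(1 + Complex.I * ξ) / (ξ - ξ⁻¹) with ha
  set b := -Complex.I - a with hb
  have ha' : a * (ξ - ξ⁻¹) = -(1 + Complex.I * ξ) := div_mul_cancel₀ _ hd
  have hinv : ξ * ξ⁻¹ = 1 := mul_inv_cancel₀ h0
  have hy : ∀ n, (orbit lam α e n).1.eval 0 = a * ξ ^ n + b * ξ⁻¹ ^ n ∧
      (orbit lam α e n).2.eval 0 = a * ξ ^ n * ξ⁻¹ + b * ξ⁻¹ ^ n * ξ := by
    intro n
    induction n with
    | zero =>
      simp only [orbit, eval_C, eval_one, pow_zero, hb]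
      exact ⟨by ring, by linear_combination ha'⟩
    | succ n ih =>
      simp only [orbit, eval_sub, eval_mul, eval_add, eval_C, eval_one, eval_X, ih.1, ih.2]
      constructor
      · linear_combination -(a * ξ ^ n + b * ξ⁻¹ ^ n) * hsum
      · linear_combination -(a * ξ ^ n + b * ξ⁻¹ ^ n) * hinv
  refine ⟨a * (1 - Complex.I * ξ⁻¹), b * (1 - Complex.I * ξ), ?_, fun n => ?_⟩
  · have h1 : 1 - Complex.I * ξ⁻¹ = (ξ - Complex.I) / ξ := by field_simp
    have h2 : -(1 + Complex.I * ξ) = -Complex.I * (ξ - Complex.I) := by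
      linear_combination -Complex.I_sq
    rw [h1, ha, h2]
    exact mul_ne_zero (div_ne_zero (mul_ne_zero (neg_ne_zero.2 Complex.I_ne_zero) hI) hd)
      (div_ne_zero hI h0)
  · rw [orbitSum, eval_sub, eval_mul, eval_C, (hy n).1, (hy n).2]
    ring

/-- The Lyapunov exponent of the Maryland cocycle is `log |ξ|`, where `ξ` is the root outside the
unit disc of `ξ + ξ⁻¹ = e - i lam`. -/
theorem lyapunovExponent_eq {lam : ℝ} (hlam : 0 < lam) (α e : ℝ) {ξ : ℂ} (hξ : 1 < ‖ξ‖)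
    (hsum : ξ + ξ⁻¹ = e - Complex.I * lam) : lyapunovExponent lam α e = Real.log ‖ξ‖ := by
  obtain ⟨a, b, ha, hab⟩ := exists_orbitSum_eval_zero α hξ hsum
  have h0 : ξ ≠ 0 := norm_pos_iff.1 (zero_lt_one.trans hξ)
  have hq : Tendsto (fun n : ℕ => a + b * (ξ⁻¹ * ξ⁻¹) ^ n) atTop (𝓝 a) := by
    have : Tendsto (fun n : ℕ => (ξ⁻¹ * ξ⁻¹) ^ n) atTop (𝓝 0) := by
      apply tendsto_pow_atTop_nhds_zero_of_norm_lt_one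
      rw [norm_mul, norm_inv]
      have := inv_lt_one_of_one_lt₀ hξ
      have h2 : 0 ≤ ‖ξ‖⁻¹ := by positivity
      nlinarith
    simpa using (this.const_mul b).const_add a
  have hlog : Tendsto (fun n : ℕ => Real.log ‖a + b * (ξ⁻¹ * ξ⁻¹) ^ n‖) atTop
      (𝓝 (Real.log ‖a‖)) := hq.norm.log (norm_ne_zero_iff.2 ha)
  have hS : ∀ᶠ n : ℕ in atTop, (1 / (n : ℝ)) * Real.log ‖(orbitSum lam α e n).eval 0‖ =
      Real.log ‖ξ‖ + (1 / (n : ℝ)) * Real.log ‖a + b * (ξ⁻¹ * ξ⁻¹) ^ n‖ := by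
    filter_upwards [eventually_gt_atTop 0, hq.eventually_ne ha] with n hn hne
    have hfac : a * ξ ^ n + b * ξ⁻¹ ^ n = ξ ^ n * (a + b * (ξ⁻¹ * ξ⁻¹) ^ n) := by
      rw [mul_pow, inv_pow]
      field_simp
    rw [hab, hfac, norm_mul, norm_pow, Real.log_mul (by positivity) (norm_ne_zero_iff.2 hne),
      Real.log_pow]
    have : (n : ℝ) ≠ 0 := by exact_mod_cast hn.ne'
    field_simp
  have hinv : Tendsto (fun n : ℕ => 1 / (n : ℝ)) atTop (𝓝 0) :=
    tendsto_one_div_atTop_nhds_zero_nat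
  have hlim : Tendsto (fun n : ℕ => (1 / (n : ℝ)) * Real.log ‖(orbitSum lam α e n).eval 0‖) atTop
      (𝓝 (Real.log ‖ξ‖)) := by
    have := (hinv.mul hlog).const_add (Real.log ‖ξ‖)
    rw [zero_mul, add_zero] at this
    exact this.congr' (hS.mono fun n hn => hn.symm)
  have hlim' : Tendsto (fun n : ℕ => (1 / (n : ℝ)) *
      (Real.log ‖(orbitSum lam α e n).eval 0‖ - Real.log 4)) atTop (𝓝 (Real.log ‖ξ‖)) := by
    have := hlim.sub (hinv.mul_const (Real.log 4))
    rw [zero_mul, sub_zero] at this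
    exact this.congr fun n => by ring
  -- The loss `log 4` in comparing norms disappears after division by `n`, so the squeeze also
  -- proves that the limit exists.
  refine Tendsto.limUnder_eq (tendsto_of_tendsto_of_tendsto_of_le_of_le hlim' hlim ?_ ?_)
  · intro n
    exact mul_le_mul_of_nonneg_left (integral_log_norm_transferProduct_bounds hlam α e n).1
      (by positivity)
  · intro n
    exact mul_le_mul_of_nonneg_left (integral_log_norm_transferProduct_bounds hlam α e n).2
      (by positivity)

theorem exists_joukowski_root {lam : ℝ} (hlam : 0 < lam) (e : ℝ) :
    ∃ ξ : ℂ, 1 < ‖ξ‖ ∧ ξ + ξ⁻¹ = e - Complex.I * lam :=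
  exists_add_inv_eq (by simpa using hlam.ne')

/-- For fixed `|ξ|` the point `ξ + ξ⁻¹` runs over an ellipse centred at `0`, and a horizontal line
meets it in points with the same `e²`. The relation `key` is the equation of this ellipse with
denominators cleared. -/
theorem sq_eq_of_lyapunovExponent_eq {lam : ℝ} (hlam : 0 < lam) {α e e' : ℝ}
    (h : lyapunovExponent lam α e = lyapunovExponent lam α e') : e ^ 2 = e' ^ 2 := by
  have key : ∀ e : ℝ, ∀ ξ : ℂ, 1 < ‖ξ‖ → ξ + ξ⁻¹ = e - Complex.I * lam →
      e ^ 2 * (‖ξ‖ ^ 2 - 1) ^ 2 * ‖ξ‖ ^ 2 =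
        (‖ξ‖ ^ 2 + 1) ^ 2 * ((‖ξ‖ ^ 2 - 1) ^ 2 - lam ^ 2 * ‖ξ‖ ^ 2) := by
    intro e ξ hξ hsum
    have hn : Complex.normSq ξ = ‖ξ‖ ^ 2 := Complex.normSq_eq_norm_sq ξ
    have hr := congrArg Complex.re hsum
    have hi := congrArg Complex.im hsum
    simp [hn] at hr hi
    have hN : ξ.re ^ 2 + ξ.im ^ 2 = ‖ξ‖ ^ 2 := by rw [← hn, Complex.normSq_apply]; ring
    have hpos : ‖ξ‖ ^ 2 ≠ 0 := by positivity
    set N := ‖ξ‖ ^ 2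
    have hr' : ξ.re * (N + 1) = e * N := by field_simp at hr; linarith
    have hi' : ξ.im * (N - 1) = -lam * N := by field_simp at hi; linarith
    have h1 : N * (e ^ 2 * (N - 1) ^ 2 * N) =
        N * ((N + 1) ^ 2 * ((N - 1) ^ 2 - lam ^ 2 * N)) := by
      linear_combination (-(N - 1) ^ 2 * (e * N + ξ.re * (N + 1))) * hr' +
        (N + 1) ^ 2 * (N - 1) ^ 2 * hN - (N + 1) ^ 2 * (ξ.im * (N - 1) - lam * N) * hi'
    exact mul_left_cancel₀ hpos h1
  obtain ⟨ξ, hξ, hs⟩ := exists_joukowski_root hlam e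
  obtain ⟨ξ', hξ', hs'⟩ := exists_joukowski_root hlam e'
  rw [lyapunovExponent_eq hlam α e hξ hs, lyapunovExponent_eq hlam α e' hξ' hs'] at h
  have hnorm : ‖ξ‖ = ‖ξ'‖ := Real.log_injOn_pos (zero_lt_one.trans hξ) (zero_lt_one.trans hξ') h
  have k := key e ξ hξ hs
  have k' := key e' ξ' hξ' hs'
  rw [← hnorm] at k'
  have hne : (‖ξ‖ ^ 2 - 1) ^ 2 * ‖ξ‖ ^ 2 ≠ 0 := by
    have : 0 < ‖ξ‖ ^ 2 - 1 := by nlinarith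
    positivity
  exact mul_right_cancel₀ hne (by linarith)

theorem encard_lyapunovExponent_fiber_le {lam : ℝ} (hlam : 0 < lam) (α : ℝ) (d : EReal) :
    {e : ℝ | (lyapunovExponent lam α e : EReal) = d}.encard ≤ 2 := by
  rcases Set.eq_empty_or_nonempty {e : ℝ | (lyapunovExponent lam α e : EReal) = d} with h | ⟨e₀, h₀⟩
  · simp [h]
  · refine (Set.encard_le_encard (t := {e₀, -e₀}) fun e he => ?_).trans ?_
    · have heq : lyapunovExponent lam α e = lyapunovExponent lam α e₀ :=
        EReal.coe_injective (Eq.trans he (Eq.symm h₀))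
      exact sq_eq_sq_iff_eq_or_eq_neg.1 (sq_eq_of_lyapunovExponent_eq hlam heq)
    · exact (Set.encard_insert_le _ _).trans (by rw [Set.encard_singleton]; norm_num)

end

/-! ### Fourier coefficients and the cohomological equation. -/

section

open Filter Topology MeasureTheory

theorem continuous_expChar : Continuous expChar := by unfold expChar; fun_prop

theorem differentiable_expChar : Differentiable ℂ expChar := by unfold expChar; fun_prop

theorem hasDerivAt_expChar_mul (c : ℂ) (x : ℝ) :
    HasDerivAt (fun y : ℝ => expChar (c * y)) (2 * Real.pi * Complex.I * c * expChar (c * x)) x := by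
  have h : HasDerivAt (fun y : ℂ => expChar (c * y))
      (2 * Real.pi * Complex.I * c * expChar (c * x)) x := by
    unfold expChar
    have h1 : HasDerivAt (fun y : ℂ => 2 * Real.pi * Complex.I * (c * y))
        (2 * Real.pi * Complex.I * c) (x : ℂ) := by
      simpa [mul_assoc] using ((hasDerivAt_id (x : ℂ)).const_mul c).const_mul
        (2 * Real.pi * Complex.I : ℂ)
    convert! h1.cexp using 1
    ring
  exact h.comp_ofReal

theorem expChar_add_int (x : ℂ) (n : ℤ) : expChar (x + n) = expChar x := by
  rw [expChar_add, expChar_int, mul_one]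

theorem norm_expChar_int_mul_ofReal (n : ℤ) (x : ℝ) : ‖expChar (n * x)‖ = 1 := by
  have := norm_expChar_ofReal (n * x)
  push_cast at this
  exact this

theorem integral_expChar_int (n : ℤ) :
    ∫ x in (0 : ℝ)..1, expChar (n * x) = if n = 0 then 1 else 0 := by
  split_ifs with h
  · simp [h, expChar_zero]
  · have hc : (2 * Real.pi * Complex.I * n : ℂ) ≠ 0 := by
      simp [Real.pi_ne_zero, h]
    have hd : ∀ x ∈ Set.uIcc (0 : ℝ) 1, HasDerivAt
        (fun y : ℝ => expChar (n * y) / (2 * Real.pi * Complex.I * n)) (expChar (n * x)) x := by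
      intro x _
      have := (hasDerivAt_expChar_mul n x).div_const (2 * Real.pi * Complex.I * n)
      rwa [mul_div_cancel_left₀ _ hc] at this
    rw [intervalIntegral.integral_eq_sub_of_hasDerivAt hd
      (Continuous.intervalIntegrable (continuous_expChar.comp (by fun_prop)) _ _)]
    simp [expChar_zero, expChar_int]

/-- Fourier coefficients of an absolutely convergent Fourier series. -/
theorem integral_mul_expChar_of_hasSum {a : ℤ → ℂ} (ha : Summable fun n => ‖a n‖) {f : ℝ → ℂ}
    (hf : ∀ x : ℝ, HasSum (fun n : ℤ => a n * expChar (n * x)) (f x)) (m : ℤ) :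
    ∫ x in (0 : ℝ)..1, f x * expChar (-m * x) = a m := by
  have key := intervalIntegral.hasSum_integral_of_dominated_convergence (μ := volume) (a := 0)
    (b := 1) (F := fun (n : ℤ) (x : ℝ) => a n * expChar (n * x) * expChar (-m * x))
    (f := fun x => f x * expChar (-m * x)) (fun n _ => ‖a n‖) ?_ ?_ ?_ ?_ ?_
  · have hterm : ∀ n : ℤ, ∫ x in (0 : ℝ)..1, a n * expChar (n * x) * expChar (-m * x) =
        if n = m then a m else 0 := by
      intro n
      have h1 : ∀ x : ℝ, a n * expChar (n * x) * expChar (-m * x) =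
          a n * expChar ((n - m : ℤ) * x) := by
        intro x
        rw [mul_assoc, ← expChar_add]
        congr 2; push_cast; ring
      simp only [h1]
      rw [intervalIntegral.integral_const_mul, integral_expChar_int]
      by_cases h : n = m
      · simp [h]
      · simp [h, sub_eq_zero]
    simp only [hterm] at key
    exact key.unique (hasSum_ite_eq m (a m))
  · intro n
    refine Continuous.aestronglyMeasurable ?_
    exact (continuous_const.mul (continuous_expChar.comp (by fun_prop))).mul
      (continuous_expChar.comp (by fun_prop))
  · intro n
    refine ae_of_all _ fun x _ => ?_
    have h := norm_expChar_int_mul_ofReal (-m) x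
    push_cast at h
    rw [norm_mul, norm_mul, norm_expChar_int_mul_ofReal, h, mul_one, mul_one]
  · exact ae_of_all _ fun _ _ => ha
  · exact intervalIntegrable_const
  · exact ae_of_all _ fun x _ => (hf x).mul_right _

theorem eq_const_of_hasDerivAt_zero {f : ℝ → ℂ} (hf : ∀ x, HasDerivAt f 0 x) (x : ℝ) :
    f x = f 0 :=
  is_const_of_deriv_eq_zero (fun y => (hf y).differentiableAt) (fun y => (hf y).deriv) x 0

/-- A nowhere vanishing solution `f` of `f (x + α) = κ e^{F x} f x` on the circle, with `F` of mean
zero: its winding number quantizes `κ`, and its logarithmic derivative `g` solves the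
differentiated cohomological equation. -/
theorem cohomological_equation {f g F : ℝ → ℂ} {a : ℤ → ℂ} {α : ℝ} {κ : ℂ}
    (hf : ∀ x, HasDerivAt f (g x * f x) x) (hg : Continuous g) (hgp : Function.Periodic g 1)
    (hfp : Function.Periodic f 1) (hf0 : f 0 ≠ 0) (hF : Differentiable ℝ F)
    (ha : Summable fun n => ‖a n‖) (ha0 : a 0 = 0)
    (hFa : ∀ x : ℝ, HasSum (fun n : ℤ => a n * expChar (n * x)) (F x))
    (heq : ∀ x, f (x + α) = κ * Complex.exp (F x) * f x) :
    ∃ k : ℤ, κ = expChar (k * α) ∧ ∀ n : ℤ,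
      (∫ x in (0 : ℝ)..1, g x * expChar (-n * x)) * (expChar (n * α) - 1) =
        2 * Real.pi * Complex.I * n * a n := by
  set L : ℝ → ℂ := fun x => ∫ y in (0 : ℝ)..x, g y with hL
  have hLd : ∀ x, HasDerivAt L (g x) x := fun x => (hg.integral_hasStrictDerivAt 0 x).hasDerivAt
  have hL0 : L 0 = 0 := by simp [hL]
  have hfL : ∀ x, f x = f 0 * Complex.exp (L x) := by
    intro x
    have h1 : ∀ y, HasDerivAt (fun y => f y * Complex.exp (-L y)) 0 y := by
      intro y
      convert! (hf y).mul (hLd y).neg.cexp using 1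
      ring
    have h2 := eq_const_of_hasDerivAt_zero h1 x
    simp only [hL0, neg_zero, Complex.exp_zero, mul_one] at h2
    rw [← h2, mul_assoc, ← Complex.exp_add]
    simp
  -- `L` is a logarithm of `f / f 0` lifted to the line, and `k` is the winding number of `f`.
  obtain ⟨k, hk⟩ : ∃ k : ℤ, L 1 = k * (2 * Real.pi * Complex.I) := by
    rw [← Complex.exp_eq_one_iff]
    have h1 := hfL 1
    have h2 : f 1 = f 0 := by simpa using hfp 0
    rw [h2] at h1
    exact mul_left_cancel₀ hf0 (by rw [← h1, mul_one])
  have hLper : ∀ x, L (x + 1) = L x + k * (2 * Real.pi * Complex.I) := by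
    intro x
    rw [← hk]
    have := hgp.intervalIntegral_add_eq x 0
    rw [zero_add] at this
    simp only [hL]
    rw [← this, intervalIntegral.integral_add_adjacent_intervals] <;>
      exact hg.intervalIntegrable _ _
  set φ : ℝ → ℂ := fun x => L x - 2 * Real.pi * Complex.I * k * x with hφ
  have hφp : Function.Periodic φ 1 := by
    intro x
    simp only [hφ, hLper]
    push_cast; ring
  have hφd : ∀ x, HasDerivAt φ (g x - 2 * Real.pi * Complex.I * k) x := by
    intro x
    have h1 : HasDerivAt (fun y : ℝ => 2 * Real.pi * Complex.I * k * (y : ℂ))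
        (2 * Real.pi * Complex.I * k) x := by
      simpa using ((hasDerivAt_id (x : ℂ)).const_mul (2 * Real.pi * Complex.I * k : ℂ)).comp_ofReal
    exact (hLd x).sub h1
  have hφc : Continuous φ := continuous_iff_continuousAt.2 fun x => (hφd x).continuousAt
  -- The exponential of the difference is the constant `κ`; differentiating shows that the
  -- difference itself is constant, so no branch of the logarithm of `f` is needed.
  obtain ⟨K₀, hK⟩ : ∃ K₀ : ℂ, ∀ x, L (x + α) - L x = F x + K₀ := by
    have hexp : ∀ x, Complex.exp (L (x + α) - L x - F x) = κ := by
      intro x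
      have h1 := heq x
      rw [hfL, hfL x] at h1
      have h2 : Complex.exp (L (x + α)) = κ * Complex.exp (F x) * Complex.exp (L x) :=
        mul_left_cancel₀ hf0 (by rw [h1]; ring)
      rw [Complex.exp_sub, Complex.exp_sub, h2]
      field_simp
    have hd : ∀ x, HasDerivAt (fun y => L (y + α) - L y - F y)
        (g (x + α) - g x - deriv F x) x := fun x =>
      (((hLd (x + α)).comp_add_const x α).sub (hLd x)).sub (hF x).hasDerivAt
    have hd0 : ∀ x, g (x + α) - g x - deriv F x = 0 := by
      intro x
      have h1 := (hd x).cexp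
      simp only [hexp] at h1
      have h2 := h1.unique (hasDerivAt_const x κ)
      rcases mul_eq_zero.1 h2 with h3 | h3
      · exact absurd (hexp x ▸ h3) (Complex.exp_ne_zero _)
      · exact h3
    refine ⟨L (0 + α) - L 0 - F 0, fun x => ?_⟩
    have := eq_const_of_hasDerivAt_zero (fun y => (hd0 y) ▸ hd y) x
    linear_combination this
  have hκ : κ = Complex.exp K₀ := by
    have h1 := heq 0
    rw [hfL (0 + α)] at h1
    have h2 : Complex.exp (L (0 + α)) = κ * Complex.exp (F 0) * Complex.exp (L 0) :=
      mul_left_cancel₀ hf0 (by rw [h1, hL0, Complex.exp_zero]; ring)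
    have h3 : L (0 + α) = F 0 + K₀ + L 0 := by linear_combination hK 0
    rw [h3, Complex.exp_add, Complex.exp_add] at h2
    have h4 : Complex.exp (F 0) * Complex.exp (L 0) ≠ 0 :=
      mul_ne_zero (Complex.exp_ne_zero _) (Complex.exp_ne_zero _)
    exact (mul_right_cancel₀ h4 (by linear_combination h2)).symm
  have hdiff : ∀ x, φ (x + α) - φ x = F x + (K₀ - 2 * Real.pi * Complex.I * k * α) := by
    intro x
    simp only [hφ]
    push_cast
    linear_combination hK x
  have hcont : ∀ n : ℤ, Continuous fun x : ℝ => expChar (-n * x) := fun n =>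
    continuous_expChar.comp (by fun_prop)
  have hper : ∀ n : ℤ, Function.Periodic (fun x : ℝ => expChar (-n * x)) 1 := by
    intro n x
    have : (-n * ((x + 1 : ℝ) : ℂ) : ℂ) = -n * x + (-n : ℤ) := by push_cast; ring
    simp only [this, expChar_add_int]
  have hφn : ∀ n : ℤ, Continuous fun x : ℝ => φ x * expChar (-n * x) := fun n =>
    hφc.mul (hcont n)
  have hφnp : ∀ n : ℤ, Function.Periodic (fun x : ℝ => φ x * expChar (-n * x)) 1 := fun n =>
    hφp.mul (hper n)
  have hφα : ∀ n : ℤ, Continuous fun x : ℝ => φ (x + α) * expChar (-n * x) := fun n =>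
    (hφc.comp (continuous_add_const α)).mul (hcont n)
  have hFn : ∀ n : ℤ, Continuous fun x : ℝ => F x * expChar (-n * x) := fun n =>
    hF.continuous.mul (hcont n)
  have hgn : ∀ n : ℤ, Continuous fun x : ℝ => g x * expChar (-n * x) := fun n =>
    hg.mul (hcont n)
  have hshift : ∀ n : ℤ, ∫ x in (0 : ℝ)..1, φ (x + α) * expChar (-n * x) =
      expChar (n * α) * ∫ x in (0 : ℝ)..1, φ x * expChar (-n * x) := by
    intro n
    have h1 : ∀ x : ℝ, φ (x + α) * expChar (-n * x) =
        expChar (n * α) * (φ (x + α) * expChar (-n * (x + α : ℝ))) := by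
      intro x
      have : (-n * x : ℂ) = n * α + -n * (x + α : ℝ) := by push_cast; ring
      rw [this, expChar_add]; ring
    simp only [h1]
    rw [intervalIntegral.integral_const_mul,
      intervalIntegral.integral_comp_add_right (fun x : ℝ => φ x * expChar (-n * x)), zero_add,
      add_comm 1 α, (hφnp n).intervalIntegral_add_eq α 0, zero_add]
  have hcoef : ∀ n : ℤ, (expChar (n * α) - 1) * ∫ x in (0 : ℝ)..1, φ x * expChar (-n * x) =
      a n + (K₀ - 2 * Real.pi * Complex.I * k * α) * if n = 0 then 1 else 0 := by
    intro n
    have h1 : ∫ x in (0 : ℝ)..1, (φ (x + α) * expChar (-n * x) - φ x * expChar (-n * x)) =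
        ∫ x in (0 : ℝ)..1, (F x * expChar (-n * x) +
          (K₀ - 2 * Real.pi * Complex.I * k * α) * expChar (-n * x)) := by
      congr 1; funext x
      rw [← sub_mul, hdiff]; ring
    rw [intervalIntegral.integral_sub
        ((hφα n).intervalIntegrable _ _)
        ((hφn n).intervalIntegrable _ _), hshift,
      intervalIntegral.integral_add ((hFn n).intervalIntegrable _ _)
        (((hcont n).const_mul _).intervalIntegrable _ _),
      integral_mul_expChar_of_hasSum ha hFa, intervalIntegral.integral_const_mul] at h1
    have h2 := integral_expChar_int (-n)
    push_cast at h2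
    rw [h2] at h1
    simp only [neg_eq_zero] at h1
    linear_combination h1
  -- The coefficient `n = 0`: both `φ (x + α) - φ x` and `F` have mean zero.
  have hK₀ : K₀ = 2 * Real.pi * Complex.I * k * α := by
    have := hcoef 0
    simp [ha0, expChar_zero] at this
    linear_combination -this
  refine ⟨k, ?_, fun n => ?_⟩
  · rw [hκ, hK₀, expChar]
    congr 1; ring
  · have h1 := hcoef n
    rw [hK₀, sub_self, zero_mul, add_zero] at h1
    have hparts : ∫ x in (0 : ℝ)..1, g x * expChar (-n * x) =
        2 * Real.pi * Complex.I * n * (∫ x in (0 : ℝ)..1, φ x * expChar (-n * x)) +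
          2 * Real.pi * Complex.I * k * if n = 0 then 1 else 0 := by
      have hbp := intervalIntegral.integral_mul_deriv_eq_deriv_mul (a := 0) (b := 1)
        (u := fun x : ℝ => expChar (-n * x)) (v := φ)
        (u' := fun x : ℝ => 2 * Real.pi * Complex.I * (-n) * expChar (-n * x))
        (v' := fun x => g x - 2 * Real.pi * Complex.I * k)
        (fun x _ => hasDerivAt_expChar_mul (-n) x) (fun x _ => hφd x)
        (((hcont n).const_mul _).intervalIntegrable _ _)
        ((hg.sub continuous_const).intervalIntegrable _ _)
      have hb1 : φ 1 = φ 0 := by simpa using hφp 0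
      have hb2 : expChar (-n * (1 : ℝ)) = expChar (-n * (0 : ℝ)) := by
        simpa using hper n 0
      simp only [hb1, hb2, sub_self, zero_sub] at hbp
      have h2 := integral_expChar_int (-n)
      push_cast at h2
      simp only [neg_eq_zero] at h2
      rw [← h2, ← intervalIntegral.integral_const_mul, ← intervalIntegral.integral_const_mul]
      have h3 : ∫ x in (0 : ℝ)..1, expChar (-n * x) * (g x - 2 * Real.pi * Complex.I * k) =
          (∫ x in (0 : ℝ)..1, g x * expChar (-n * x)) -
          ∫ x in (0 : ℝ)..1, 2 * Real.pi * Complex.I * k * expChar (-n * x) := by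
        rw [← intervalIntegral.integral_sub ((hgn n).intervalIntegrable _ _)
          (((hcont n).const_mul _).intervalIntegrable _ _)]
        congr 1; funext x; ring
      have h4 : -∫ x in (0 : ℝ)..1, 2 * Real.pi * Complex.I * (-n) * expChar (-n * x) * φ x =
          ∫ x in (0 : ℝ)..1, 2 * Real.pi * Complex.I * n * (φ x * expChar (-n * x)) := by
        rw [← intervalIntegral.integral_neg]
        congr 1; funext x; ring
      rw [h3, h4] at hbp
      linear_combination hbp
    rw [hparts]
    by_cases hn : n = 0
    · simp [hn, expChar_zero]
    · simp only [hn, if_false, mul_zero, add_zero]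
      linear_combination (2 * Real.pi * Complex.I * n) * h1

end

/-! ### Holomorphy on strips, exponential decay, and logarithmic series. -/

section

open Filter Topology MeasureTheory

theorem periodic_deriv {f : ℂ → ℂ} {T : ℂ} (hf : Function.Periodic f T) :
    Function.Periodic (deriv f) T := by
  intro z
  rw [← deriv_comp_add_const]
  congr 1
  exact funext hf

/-- Fourier coefficients of the logarithmic derivative of a periodic holomorphic function on a
strip, without zeros on the real axis, decay exponentially. -/
theorem logDeriv_coefficient_decay {f : ℂ → ℂ} {τ : ℝ} (hτ : 0 < τ)
    (hf : DifferentiableOn ℂ f {z | |z.im| < τ}) (hper : Function.Periodic f 1)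
    (hne : ∀ x : ℝ, f x ≠ 0) :
    ∃ s B : ℝ, 0 < s ∧ ∀ n : ℕ,
      ‖∫ x in (0 : ℝ)..1, deriv f x / f x * expChar (-n * x)‖ ≤ B * Real.exp (-s * n) := by
  have hUo : IsOpen {z : ℂ | |z.im| < τ} :=
    isOpen_lt (Complex.continuous_im.abs) continuous_const
  set V : Set ℂ := {z | |z.im| < τ} ∩ f ⁻¹' {0}ᶜ with hV
  have hVo : IsOpen V := hf.continuousOn.isOpen_inter_preimage hUo isOpen_compl_singleton
  have hgV : DifferentiableOn ℂ (fun z => deriv f z / f z) V := by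
    refine DifferentiableOn.div ((hf.deriv hUo).mono Set.inter_subset_left)
      (hf.mono Set.inter_subset_left) fun z hz => hz.2
  have hK : IsCompact ((fun x : ℝ => (x : ℂ)) '' Set.Icc 0 1) :=
    isCompact_Icc.image Complex.continuous_ofReal
  obtain ⟨η, hη, hthick⟩ := hK.exists_thickening_subset_open hVo (by
    rintro _ ⟨x, -, rfl⟩
    exact ⟨by simpa using hτ, hne x⟩)
  have hmem : ∀ x ∈ Set.Icc (0 : ℝ) 1, ∀ y : ℝ, |y| < η → (x + y * Complex.I : ℂ) ∈ V := by
    intro x hx y hy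
    refine hthick (Metric.mem_thickening_iff.2 ⟨x, ⟨x, hx, rfl⟩, ?_⟩)
    simpa [dist_eq_norm] using hy
  -- Zeros stay at distance at least `η` from `[0, 1]`, so the contour can be moved down by `h`. The
  -- vertical sides cancel by periodicity, and on the lower side the character has modulus
  -- `e^{-2πhn}`.
  set h := η / 2 with hh
  have hh0 : 0 < h := by positivity
  have hline : ContinuousOn (fun x : ℝ => deriv f (x + (-h : ℝ) * Complex.I) /
      f (x + (-h : ℝ) * Complex.I)) (Set.Icc 0 1) := by
    refine hgV.continuousOn.comp (f := fun x : ℝ => (x + (-h : ℝ) * Complex.I : ℂ))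
      (by fun_prop) ?_
    intro x hx
    refine hmem x hx (-h) ?_
    rw [abs_neg, abs_of_pos hh0]
    linarith
  obtain ⟨B, hB⟩ := isCompact_Icc.exists_bound_of_continuousOn hline
  refine ⟨2 * Real.pi * h, B, by positivity, fun n => ?_⟩
  have hdper := periodic_deriv hper
  have heper : ∀ z : ℂ, expChar (-n * (z + 1)) = expChar (-n * z) := by
    intro z
    have : -(n : ℂ) * (z + 1) = -n * z + (-n : ℤ) := by push_cast; ring
    rw [this, expChar_add_int]
  have hrect := Complex.integral_boundary_rect_eq_zero_of_differentiableOn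
    (fun z => deriv f z / f z * expChar (-n * z)) (0 : ℂ) (1 + (-h : ℝ) * Complex.I) (by
      refine DifferentiableOn.mul (hgV.mono ?_)
        (differentiable_expChar.comp (by fun_prop)).differentiableOn
      rintro z ⟨hz1, hz2⟩
      have hre : z.re ∈ Set.Icc (0 : ℝ) 1 := by simpa using hz1
      have him : z.im ∈ Set.Icc (-h) 0 := by
        have hz2' : z.im ∈ Set.uIcc (0 : ℝ) (-h) := by simpa using hz2
        rwa [Set.uIcc_of_ge (by linarith)] at hz2'
      have := hmem z.re hre z.im (by rw [abs_lt]; constructor <;> linarith [him.1, him.2])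
      rwa [Complex.re_add_im] at this)
  have hright : ∀ y : ℝ, deriv f ((1 : ℝ) + y * Complex.I) / f ((1 : ℝ) + y * Complex.I) *
      expChar (-n * ((1 : ℝ) + y * Complex.I)) =
      deriv f ((0 : ℝ) + y * Complex.I) / f ((0 : ℝ) + y * Complex.I) *
        expChar (-n * ((0 : ℝ) + y * Complex.I)) := by
    intro y
    have : ((1 : ℝ) + y * Complex.I : ℂ) = ((0 : ℝ) + y * Complex.I) + 1 := by push_cast; ring
    rw [this, hdper, hper, heper]
  have hre1 : (1 + ((-h : ℝ) : ℂ) * Complex.I).re = 1 := by simp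
  have him1 : (1 + ((-h : ℝ) : ℂ) * Complex.I).im = -h := by simp
  rw [hre1, him1, Complex.zero_re, Complex.zero_im] at hrect
  simp only [hright] at hrect
  have heq : ∫ x in (0 : ℝ)..1, deriv f x / f x * expChar (-n * x) =
      ∫ x in (0 : ℝ)..1, deriv f (x + (-h : ℝ) * Complex.I) / f (x + (-h : ℝ) * Complex.I) *
        expChar (-n * (x + (-h : ℝ) * Complex.I)) := by
    simp only [Complex.ofReal_zero, zero_mul, add_zero] at hrect
    linear_combination hrect
  rw [heq]
  refine (intervalIntegral.norm_integral_le_of_norm_le_const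
    (C := B * Real.exp (-(2 * Real.pi * h) * n)) fun x hx => ?_).trans_eq (by simp)
  have hx' : x ∈ Set.Icc (0 : ℝ) 1 := by
    rw [Set.uIoc_of_le zero_le_one] at hx
    exact ⟨hx.1.le, hx.2⟩
  rw [norm_mul, norm_expChar]
  have him : (-(n : ℂ) * (x + (-h : ℝ) * Complex.I)).im = n * h := by simp
  rw [him]
  have : -2 * Real.pi * (n * h) = -(2 * Real.pi * h) * n := by ring
  rw [this]
  exact mul_le_mul_of_nonneg_right (hB x hx') (Real.exp_pos _).le

theorem summable_exp_neg_abs {s : ℝ} (hs : 0 < s) :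
    Summable fun n : ℤ => Real.exp (-s * |(n : ℝ)|) := by
  have h : Summable fun n : ℕ => Real.exp (-s * (n : ℝ)) := by
    have := Real.summable_exp_nat_mul_iff.2 (neg_lt_zero.2 hs)
    exact this.congr fun n => by rw [mul_comm]
  refine Summable.of_nat_of_neg ?_ ?_ <;> simpa using h

/-- The Laurent series `∑ cₙ e^{2πinx}`. -/
noncomputable def fourierSum (c : ℤ → ℂ) (x : ℂ) : ℂ := ∑' n : ℤ, c n * expChar (n * x)

theorem fourierSum_periodic (c : ℤ → ℂ) : Function.Periodic (fourierSum c) 1 := by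
  intro x
  refine tsum_congr fun n => ?_
  rw [mul_add, mul_one, expChar_add_int]

theorem summable_norm_of_expDecaying {c : ℤ → ℂ} (hc : ExpDecaying c) :
    Summable fun n => ‖c n‖ := by
  obtain ⟨M, t, ht, hM⟩ := hc
  exact Summable.of_nonneg_of_le (fun _ => norm_nonneg _) hM
    ((summable_exp_neg_abs ht).mul_left M)

theorem hasSum_fourierSum {c : ℤ → ℂ} (hc : Summable fun n => ‖c n‖) (x : ℝ) :
    HasSum (fun n : ℤ => c n * expChar (n * x)) (fourierSum c x) := by
  refine Summable.hasSum (Summable.of_norm ?_)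
  simpa only [norm_mul, norm_expChar_int_mul_ofReal, mul_one] using hc

theorem differentiableOn_fourierSum {c : ℤ → ℂ} (hc : ExpDecaying c) :
    ∃ τ : ℝ, 0 < τ ∧ DifferentiableOn ℂ (fourierSum c) {z | |z.im| < τ} := by
  obtain ⟨M, t, ht, hM⟩ := hc
  have hpi := Real.pi_pos
  have hM0 : 0 ≤ M := by
    have := (norm_nonneg _).trans (hM 0)
    simpa using this
  -- On this strip the characters grow at most like `e^{t|n|/2}`, which leaves half of the decay for
  -- the majorant.
  refine ⟨t / (4 * Real.pi), by positivity, ?_⟩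
  refine Complex.differentiableOn_tsum_of_summable_norm
    (u := fun n : ℤ => M * Real.exp (-(t / 2) * |(n : ℝ)|))
    ((summable_exp_neg_abs (by positivity)).mul_left M) (fun n => ?_)
    (isOpen_lt (Complex.continuous_im.abs) continuous_const) fun n w hw => ?_
  · exact ((differentiable_expChar.comp (by fun_prop)).const_mul _).differentiableOn
  · rw [norm_mul, norm_expChar]
    have him : ((n : ℂ) * w).im = n * w.im := by simp
    rw [him]
    have hw' : |w.im| ≤ t / (4 * Real.pi) := le_of_lt hw
    have h1 : -2 * Real.pi * (n * w.im) ≤ t / 2 * |(n : ℝ)| := by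
      calc -2 * Real.pi * (n * w.im) ≤ |-2 * Real.pi * (n * w.im)| := le_abs_self _
        _ = 2 * Real.pi * (|(n : ℝ)| * |w.im|) := by
          rw [abs_mul, abs_mul, abs_mul, abs_neg, abs_two, abs_of_pos hpi]
        _ ≤ 2 * Real.pi * (|(n : ℝ)| * (t / (4 * Real.pi))) := by gcongr
        _ = t / 2 * |(n : ℝ)| := by field_simp; ring
    calc ‖c n‖ * Real.exp (-2 * Real.pi * (n * w.im))
        ≤ M * Real.exp (-t * |(n : ℝ)|) * Real.exp (t / 2 * |(n : ℝ)|) := by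
          gcongr
          exact hM n
      _ = M * Real.exp (-(t / 2) * |(n : ℝ)|) := by
          rw [mul_assoc, ← Real.exp_add]
          congr 2; ring

/-- The periods of a function form a group, and the group generated by `α` and `1` is dense;
continuity does the rest. -/
theorem const_of_continuous_of_invariant {h : ℝ → ℝ} {α : ℝ} (hα : Irrational α)
    (hc : Continuous h) (h1 : ∀ x, h (x + 1) = h x) (hinv : ∀ x, h (x + α) = h x) (x : ℝ) :
    h x = h 0 := by
  have hdense : Dense (AddSubgroup.closure {α, 1} : Set ℝ) :=
    dense_addSubgroupClosure_pair_iff.2 (by simpa using hα)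
  have hsub : ∀ y ∈ AddSubgroup.closure {α, 1}, ∀ x, h (x + y) = h x := by
    intro y hy
    induction hy using AddSubgroup.closure_induction with
    | mem y hy =>
      rcases hy with rfl | hy
      · exact hinv
      · rw [Set.mem_singleton_iff.1 hy]; exact h1
    | zero => simp
    | add a b _ _ ha hb => intro x; rw [← add_assoc, hb, ha]
    | neg a _ ha => intro x; rw [← ha (x + -a), neg_add_cancel_right]
  have hclosed : IsClosed {y : ℝ | h y = h 0} := isClosed_eq hc continuous_const
  have : (AddSubgroup.closure {α, 1} : Set ℝ) ⊆ {y : ℝ | h y = h 0} := fun y hy => by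
    simpa using hsub y hy 0
  exact (hclosed.closure_subset_iff.2 this) (hdense x)

/-- The two Taylor series fill the positive and the negative frequencies. The term at `n = 0`
vanishes because division by zero gives `0`, which encodes the zero mean. -/
theorem hasSum_log_one_sub {v : ℂ} (hv : ‖v‖ < 1) (x : ℝ) :
    HasSum (fun n : ℤ => -(v ^ n.natAbs / n.natAbs) * expChar (n * x))
      (Complex.log (1 - expChar x * v) + Complex.log (1 - (expChar x)⁻¹ * v)) := by
  have hx := norm_expChar_ofReal x
  have h1 := (Complex.hasSum_taylorSeries_neg_log (z := expChar x * v)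
    (by rwa [norm_mul, hx, one_mul])).neg
  have h2 := (Complex.hasSum_taylorSeries_neg_log (z := (expChar x)⁻¹ * v)
    (by rwa [norm_mul, norm_inv, hx, inv_one, one_mul])).neg
  rw [neg_neg] at h1 h2
  have e1 : ∀ n : ℕ, -(v ^ (n : ℤ).natAbs / (n : ℤ).natAbs) * expChar ((n : ℤ) * x) =
      -((expChar x * v) ^ n / n) := by
    intro n
    rw [expChar_int_mul, zpow_natCast, Int.natAbs_natCast, mul_pow]
    ring
  have e2 : ∀ n : ℕ, -(v ^ (-(n : ℤ)).natAbs / (-(n : ℤ)).natAbs) * expChar ((-(n : ℤ) : ℤ) * x) =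
      -(((expChar x)⁻¹ * v) ^ n / n) := by
    intro n
    rw [expChar_int_mul, zpow_neg, zpow_natCast, Int.natAbs_neg, Int.natAbs_natCast, mul_pow,
      inv_pow]
    ring
  have key := HasSum.of_nat_of_neg
    (f := fun n : ℤ => -(v ^ n.natAbs / n.natAbs) * expChar (n * x))
    (by simpa only [e1] using h1) (by simpa only [e2] using h2)
  simpa using key

theorem differentiable_log_one_sub {v : ℂ} (hv : ‖v‖ < 1) :
    Differentiable ℝ fun x : ℝ =>
      Complex.log (1 - expChar x * v) + Complex.log (1 - (expChar x)⁻¹ * v) := by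
  have hslit : ∀ w : ℂ, ‖w‖ = 1 → 1 - w * v ∈ Complex.slitPlane := by
    intro w hw
    rw [sub_eq_add_neg]
    refine Complex.mem_slitPlane_of_norm_lt_one ?_
    rwa [norm_neg, norm_mul, hw, one_mul]
  have hd : ∀ c : ℂ, Differentiable ℝ fun x : ℝ => expChar (c * x) := fun c x =>
    (hasDerivAt_expChar_mul c x).differentiableAt
  have h1 : Differentiable ℝ fun x : ℝ => expChar x := by simpa using hd 1
  have h2 : Differentiable ℝ fun x : ℝ => (expChar x)⁻¹ := by
    simpa [expChar_neg] using hd (-1)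
  intro x
  refine DifferentiableAt.add ?_ ?_
  · exact (((h1 x).mul_const v).const_sub 1).hasDerivAt.clog_real
      (hslit _ (norm_expChar_ofReal x)) |>.differentiableAt
  · exact (((h2 x).mul_const v).const_sub 1).hasDerivAt.clog_real
      (hslit _ (by rw [norm_inv, norm_expChar_ofReal, inv_one])) |>.differentiableAt

theorem norm_expChar_sub_one (x : ℝ) : ‖expChar x - 1‖ = 2 * |Real.sin (Real.pi * x)| := by
  have h := expChar_sub_one x
  have h2 : ‖expChar (x / 2)‖ = 1 := by
    have := norm_expChar_ofReal (x / 2)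
    push_cast at this
    exact this
  rw [h, norm_mul, norm_mul, norm_mul, h2, Complex.norm_I, ← Complex.ofReal_mul,
    ← Complex.ofReal_sin, Complex.norm_real]
  simp

theorem norm_expChar_sub_one_bounds (x : ℝ) :
    4 * ‖(x : UnitAddCircle)‖ ≤ ‖expChar x - 1‖ ∧
      ‖expChar x - 1‖ ≤ 2 * Real.pi * ‖(x : UnitAddCircle)‖ := by
  have hpi := Real.pi_pos
  have hred : expChar x = expChar (x - round x : ℝ) := by
    have := expChar_add_int ((x - round x : ℝ) : ℂ) (round x)
    rw [← this]
    congr 1; push_cast; ring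
  rw [UnitAddCircle.norm_eq, hred, norm_expChar_sub_one]
  have hy : |x - round x| ≤ 1 / 2 := abs_sub_round x
  set y := x - round x
  constructor
  · have h := Real.mul_abs_le_abs_sin (x := Real.pi * y) (by
      rw [abs_mul, abs_of_pos hpi]; nlinarith)
    rw [abs_mul, abs_of_pos hpi] at h
    have h2 : 2 / Real.pi * (Real.pi * |y|) = 2 * |y| := by field_simp
    linarith
  · have h : |Real.sin (Real.pi * y)| ≤ |Real.pi * y| := Real.abs_sin_le_abs
    rw [abs_mul, abs_of_pos hpi] at h
    linarith

end

/-! ### From a decaying eigenfunction to the strict inequality. -/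

section

open Filter Topology MeasureTheory

theorem cos_ne_zero_of_nonresonant {α θ : ℝ} (hθ : ∀ m n : ℤ, θ ≠ 1 / 2 + m * α + n) (n : ℤ) :
    Real.cos (Real.pi * (θ + n * α)) ≠ 0 := by
  intro h0
  obtain ⟨k, hk⟩ := Real.cos_eq_zero_iff.1 h0
  have : Real.pi * (θ + n * α) = Real.pi * ((2 * k + 1) / 2) := by rw [hk]; ring
  have := mul_left_cancel₀ Real.pi_pos.ne' this
  apply hθ (-n) k
  push_cast
  linarith

theorem IsEigenfunction.apply {lam α θ e : ℝ} {u : EllTwo} (hu : IsEigenfunction lam α θ e u)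
    (n : ℤ) : u (n + 1) + u (n - 1) +
      ((lam * Real.tan (Real.pi * (θ + n * α)) : ℝ) : ℂ) * u n = e * u n := by
  obtain ⟨-, hd, h⟩ := hu
  have h1 := congrArg (fun v : EllTwo => v n) h
  exact h1.trans (congrFun (lp.coeFn_smul (e : ℂ) u) n)

theorem ExpDecaying.shift {u : ℤ → ℂ} {C t : ℝ} (ht : 0 < t)
    (hu : ∀ n : ℤ, ‖u n‖ ≤ C * Real.exp (-t * |(n : ℝ)|)) (n m : ℤ) :
    ‖u (n + m)‖ ≤ C * Real.exp (t * |(m : ℝ)|) * Real.exp (-t * |(n : ℝ)|) := by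
  have hC : 0 ≤ C := by simpa using (norm_nonneg _).trans (hu 0)
  refine (hu (n + m)).trans ?_
  rw [mul_assoc, ← Real.exp_add]
  gcongr
  push_cast
  have : |(n : ℝ)| ≤ |(n : ℝ) + m| + |(m : ℝ)| := by
    have := abs_sub ((n : ℝ) + m) m
    rwa [add_sub_cancel_right] at this
  nlinarith

/-- The denominators may come arbitrarily close to zero, but `1 / (1 + e^{2πiy}) = (1 - i tan πy) /
2`, and the eigenvalue equation expresses `λ tan · u_n` through `u_n` and its neighbours, which
decay. -/
theorem expDecaying_div_one_add_expChar {lam α θ e : ℝ} (hlam : 0 < lam) {u : ℤ → ℂ}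
    (hcos : ∀ n : ℤ, Real.cos (Real.pi * (θ + n * α)) ≠ 0)
    (heq : ∀ n : ℤ, u (n + 1) + u (n - 1) +
      ((lam * Real.tan (Real.pi * (θ + n * α)) : ℝ) : ℂ) * u n = e * u n)
    (hu : ExpDecaying u) : ExpDecaying fun n => u n / (1 + expChar (θ + n * α : ℝ)) := by
  obtain ⟨M, t, ht, hM⟩ := hu
  refine ⟨(M + (|e| * M + 2 * (M * Real.exp t)) / lam) / 2, t, ht, fun n => ?_⟩
  set r := Real.exp (-t * |(n : ℝ)|)
  have h1 : ‖u (n + 1)‖ ≤ M * Real.exp t * r := by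
    simpa [r] using ExpDecaying.shift ht hM n 1
  have h2 : ‖u (n - 1)‖ ≤ M * Real.exp t * r := by
    simpa [r, sub_eq_add_neg] using ExpDecaying.shift ht hM n (-1)
  set T : ℝ := Real.tan (Real.pi * (θ + n * α))
  have hT : lam * ‖(T : ℂ) * u n‖ ≤ (|e| * M + 2 * (M * Real.exp t)) * r := by
    have h3 : ((lam : ℝ) : ℂ) * (T * u n) = e * u n - u (n + 1) - u (n - 1) := by
      have := heq n
      rw [Complex.ofReal_mul] at this
      linear_combination this
    have h4 : lam * ‖(T : ℂ) * u n‖ = ‖e * u n - u (n + 1) - u (n - 1)‖ := by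
      rw [← h3, norm_mul (lam : ℂ), Complex.norm_real, Real.norm_of_nonneg hlam.le]
    have h5 : ‖(e : ℂ) * u n‖ ≤ |e| * (M * r) := by
      rw [norm_mul, Complex.norm_real, Real.norm_eq_abs]
      exact mul_le_mul_of_nonneg_left (hM n) (abs_nonneg e)
    rw [h4]
    refine (norm_sub_le _ _).trans ?_
    have := norm_sub_le ((e : ℂ) * u n) (u (n + 1))
    linarith
  have hdiv : u n / (1 + expChar (θ + n * α : ℝ)) = (u n - Complex.I * (T * u n)) / 2 := by
    rw [div_eq_div_iff (one_add_expChar_ne_zero (hcos n)) two_ne_zero]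
    linear_combination (Complex.I * u n) * one_add_expChar_mul_tan (hcos n) -
      (u n * (expChar (θ + n * α : ℝ) - 1)) * Complex.I_sq
  have hT' : ‖(T : ℂ) * u n‖ ≤ (|e| * M + 2 * (M * Real.exp t)) / lam * r := by
    rw [div_mul_eq_mul_div, le_div_iff₀ hlam]
    linarith
  change ‖u n / (1 + expChar (θ + n * α : ℝ))‖ ≤ _
  rw [hdiv, norm_div, Complex.norm_ofNat, div_le_iff₀ two_pos]
  refine (norm_sub_le _ _).trans ?_
  rw [norm_mul, Complex.norm_I, one_mul]
  have := hM n
  linarith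

/-- The first order functional equation satisfied by the Fourier transform of an eigenfunction. -/
theorem fourierSum_functional_equation {lam α θ e : ℝ} {c : ℤ → ℂ}
    (hc : Summable fun n => ‖c n‖)
    (heq : ∀ n : ℤ, (1 + expChar (θ + (n + 1 : ℤ) * α : ℝ)) * c (n + 1) +
      (1 + expChar (θ + (n - 1 : ℤ) * α : ℝ)) * c (n - 1) -
      Complex.I * lam * (expChar (θ + n * α : ℝ) - 1) * c n =
        e * ((1 + expChar (θ + n * α : ℝ)) * c n)) (x : ℝ) :
    (expChar x + (expChar x)⁻¹ - (e - Complex.I * lam)) * fourierSum c x =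
      -(expChar x + (expChar x)⁻¹ - (e + Complex.I * lam)) * expChar θ *
        fourierSum c (x + α : ℝ) := by
  set z := expChar x with hz
  have hz0 : z ≠ 0 := expChar_ne_zero _
  have h1 := hasSum_fourierSum hc x
  have h2 : HasSum (fun n : ℤ => expChar (θ + n * α : ℝ) * c n * expChar (n * x))
      (expChar θ * fourierSum c (x + α : ℝ)) := by
    refine ((hasSum_fourierSum hc (x + α)).mul_left (expChar θ)).congr_fun fun n => ?_
    have e1 : (n * (x + α : ℝ) : ℂ) = n * x + n * α := by push_cast; ring
    have e2 : ((θ + n * α : ℝ) : ℂ) = θ + n * α := by push_cast; ring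
    rw [e1, e2, expChar_add, expChar_add]; ring
  have h3 : HasSum (fun n : ℤ => (1 + expChar (θ + n * α : ℝ)) * c n * expChar (n * x))
      (fourierSum c x + expChar θ * fourierSum c (x + α : ℝ)) :=
    (h1.add h2).congr_fun fun n => by ring
  have h4 := ((Equiv.addRight (1 : ℤ)).hasSum_iff.2 h3).mul_left z⁻¹
  have h5 := ((Equiv.subRight (1 : ℤ)).hasSum_iff.2 h3).mul_left z
  have h6 := ((h4.add h5).sub (h3.mul_left (e : ℂ))).sub
    ((h2.sub h1).mul_left (Complex.I * lam))
  -- Each term of the combined, reindexed series is `e^{2πinx}` times the eigenvalue equation at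
  -- `n`, hence zero.
  have h7 : HasSum (fun _ : ℤ => (0 : ℂ)) _ := h6.congr_fun fun n => by
    simp only [Function.comp_apply, Equiv.coe_addRight, Equiv.subRight_apply]
    have e1 : expChar (((n + 1 : ℤ) : ℂ) * x) = z * expChar (n * x) := by
      rw [hz, ← expChar_add]; congr 1; push_cast; ring
    have e2 : expChar (((n - 1 : ℤ) : ℂ) * x) = z⁻¹ * expChar (n * x) := by
      rw [hz, ← expChar_neg, ← expChar_add]; congr 1; push_cast; ring
    rw [e1, e2]
    have hzz : z⁻¹ * z = 1 := inv_mul_cancel₀ hz0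
    linear_combination (-expChar (n * x)) * heq n -
      expChar (n * x) * ((1 + expChar (θ + (n + 1 : ℤ) * α : ℝ)) * c (n + 1) +
        (1 + expChar (θ + (n - 1 : ℤ) * α : ℝ)) * c (n - 1)) * hzz
  have h8 := h7.unique hasSum_zero
  linear_combination h8

theorem sub_joukowski_eq {z ξ : ℂ} (hz : z ≠ 0) (hξ : ξ ≠ 0) :
    z + z⁻¹ - (ξ + ξ⁻¹) = -ξ * ((1 - z * ξ⁻¹) * (1 - z⁻¹ * ξ⁻¹)) := by
  field_simp
  ring

theorem one_sub_mul_ne_zero {w v : ℂ} (hw : ‖w‖ = 1) (hv : ‖v‖ < 1) : 1 - w * v ≠ 0 := by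
  intro h
  have := congrArg norm (sub_eq_zero.1 h)
  rw [norm_mul, hw, norm_one] at this
  linarith

/-- The modulus is constant on the real line, so a single zero would make the series vanish there
and kill every coefficient. -/
theorem fourierSum_ne_zero {α : ℝ} (hα : Irrational α) {c : ℤ → ℂ} (hc : ExpDecaying c)
    (hne : ∃ n, c n ≠ 0) (hinv : ∀ x : ℝ, ‖fourierSum c (x + α : ℝ)‖ = ‖fourierSum c x‖) (x : ℝ) :
    fourierSum c x ≠ 0 := by
  have hs := summable_norm_of_expDecaying hc
  obtain ⟨τ, hτ, hd⟩ := differentiableOn_fourierSum hc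
  have hcont : Continuous fun x : ℝ => fourierSum c x :=
    hd.continuousOn.comp_continuous Complex.continuous_ofReal fun x => by simpa using hτ
  have hconst := const_of_continuous_of_invariant (h := fun x : ℝ => ‖fourierSum c x‖) hα
    hcont.norm (fun x => by push_cast; rw [fourierSum_periodic]) hinv
  intro h0
  obtain ⟨n, hn⟩ := hne
  have hall : ∀ y : ℝ, fourierSum c y = 0 := by
    intro y
    rw [← norm_eq_zero]
    exact (hconst y).trans ((hconst x).symm.trans (by rw [h0, norm_zero]))
  have := integral_mul_expChar_of_hasSum hs (hasSum_fourierSum hs) n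
  simp [hall] at this
  exact hn this.symm

theorem hasExpDecayingEigenfunction_delta_lt {lam α θ e : ℝ} (hlam : 0 < lam) (hα : Irrational α)
    (hθ : ∀ m n : ℤ, θ ≠ 1 / 2 + m * α + n) (h : HasExpDecayingEigenfunction lam α θ e) :
    delta α θ < (lyapunovExponent lam α e : EReal) := by
  obtain ⟨u, hu, hdec⟩ := h
  obtain ⟨ξ, hξ, hsum⟩ := exists_joukowski_root hlam e
  rw [lyapunovExponent_eq hlam α e hξ hsum]
  have hcos := cos_ne_zero_of_nonresonant hθ
  have hue := hu.apply
  set c : ℤ → ℂ := fun n => u n / (1 + expChar (θ + n * α : ℝ)) with hcdef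
  have hc : ExpDecaying c := expDecaying_div_one_add_expChar hlam hcos hue hdec
  have hs := summable_norm_of_expDecaying hc
  have huc : ∀ n : ℤ, (1 + expChar (θ + n * α : ℝ)) * c n = u n := fun n =>
    mul_div_cancel₀ _ (one_add_expChar_ne_zero (hcos n))
  have hne : ∃ n, c n ≠ 0 := by
    by_contra! hall
    apply hu.1
    ext n
    rw [← huc n, hall n]
    simp
  have hfe := fourierSum_functional_equation (lam := lam) (θ := θ) (α := α) (e := e) hs (by
    intro n
    rw [huc, huc, huc, ← hue n]
    push_cast
    have := one_add_expChar_mul_tan (hcos n)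
    rw [← huc n]
    push_cast at this ⊢
    linear_combination (-lam * c n) * this)
  set η := (starRingEnd ℂ) ξ with hη
  have hηn : ‖η‖ = ‖ξ‖ := Complex.norm_conj ξ
  have hξ0 : ξ ≠ 0 := norm_pos_iff.1 (zero_lt_one.trans hξ)
  have hη0 : η ≠ 0 := norm_pos_iff.1 (by rw [hηn]; exact zero_lt_one.trans hξ)
  have hsum' : η + η⁻¹ = e + Complex.I * lam := by
    have := congrArg (starRingEnd ℂ) hsum
    simpa using this
  have hξi : ‖ξ⁻¹‖ < 1 := by rw [norm_inv]; exact inv_lt_one_of_one_lt₀ hξ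
  have hηi : ‖η⁻¹‖ < 1 := by rw [norm_inv, hηn]; exact inv_lt_one_of_one_lt₀ hξ
  have hz1 : ∀ x : ℝ, ‖expChar x‖ = 1 := norm_expChar_ofReal
  have hz1' : ∀ x : ℝ, ‖(expChar x)⁻¹‖ = 1 := fun x => by rw [norm_inv, hz1, inv_one]
  have hE : ∀ x : ℝ, expChar x + (expChar x)⁻¹ - (e - Complex.I * lam) ≠ 0 := by
    intro x
    rw [← hsum, sub_joukowski_eq (expChar_ne_zero _) hξ0]
    exact mul_ne_zero (neg_ne_zero.2 hξ0) (mul_ne_zero (one_sub_mul_ne_zero (hz1 x) hξi)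
      (one_sub_mul_ne_zero (hz1' x) hξi))
  -- On the circle `z + z⁻¹` is real, so the two factors are complex conjugates.
  have hEconj : ∀ x : ℝ, ‖expChar x + (expChar x)⁻¹ - (e + Complex.I * lam)‖ =
      ‖expChar x + (expChar x)⁻¹ - (e - Complex.I * lam)‖ := by
    intro x
    rw [← Complex.norm_conj]
    congr 1
    rw [Complex.inv_eq_conj (hz1 x)]
    simp
    ring
  have hinv : ∀ x : ℝ, ‖fourierSum c (x + α : ℝ)‖ = ‖fourierSum c x‖ := by
    intro x
    have h1 := congrArg norm (hfe x)
    rw [norm_mul, norm_mul, norm_mul, norm_neg, hz1, mul_one, hEconj] at h1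
    exact (mul_left_cancel₀ (norm_ne_zero_iff.2 (hE x)) h1).symm
  have hC0 := fourierSum_ne_zero hα hc hne hinv
  obtain ⟨τ, hτ, hd⟩ := differentiableOn_fourierSum hc
  obtain ⟨s, B, hs0, hB⟩ := logDeriv_coefficient_decay hτ hd (fourierSum_periodic c) hC0
  set f := fourierSum c with hf
  have hUo : IsOpen {z : ℂ | |z.im| < τ} :=
    isOpen_lt (Complex.continuous_im.abs) continuous_const
  have hreal : ∀ x : ℝ, (x : ℂ) ∈ {z : ℂ | |z.im| < τ} := fun x => by simpa using hτ
  have hdper := periodic_deriv (fourierSum_periodic c)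
  have hcont : Continuous fun x : ℝ => f x :=
    hd.continuousOn.comp_continuous Complex.continuous_ofReal hreal
  have hdcont : Continuous fun x : ℝ => deriv f x :=
    (hd.deriv hUo).continuousOn.comp_continuous Complex.continuous_ofReal hreal
  set a : ℤ → ℂ := fun n => -(ξ⁻¹ ^ n.natAbs / n.natAbs) + η⁻¹ ^ n.natAbs / n.natAbs with ha
  have hgeom : ∀ v : ℂ, ‖v‖ < 1 → Summable fun n : ℤ => ‖v ^ n.natAbs / n.natAbs‖ := by
    intro v hv
    have hv' : Summable fun n : ℕ => ‖v‖ ^ n := summable_geometric_of_lt_one (norm_nonneg _) hv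
    have hn : Summable fun n : ℕ => ‖v ^ n / n‖ := by
      refine Summable.of_nonneg_of_le (fun _ => norm_nonneg _) (fun n => ?_) hv'
      rw [norm_div, norm_pow, Complex.norm_natCast]
      rcases Nat.eq_zero_or_pos n with rfl | hn
      · simp
      · exact div_le_self (by positivity) (by exact_mod_cast hn)
    refine Summable.of_nat_of_neg ?_ ?_ <;> simpa using hn
  -- `sub_joukowski_eq` splits both factors: the prefactors `-ξ` and `-η` go into `κ`, and the
  -- remaining ones have logarithms of mean zero, which form `F`.
  obtain ⟨k, hκ, hcoef⟩ := cohomological_equation (f := fun x : ℝ => f x)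
    (g := fun x : ℝ => deriv f x / f x)
    (F := fun x : ℝ => (Complex.log (1 - expChar x * ξ⁻¹) + Complex.log (1 - (expChar x)⁻¹ * ξ⁻¹)) -
      (Complex.log (1 - expChar x * η⁻¹) + Complex.log (1 - (expChar x)⁻¹ * η⁻¹)))
    (a := a) (α := α) (κ := -(expChar θ)⁻¹ * (ξ / η))
    (fun x => by
      rw [div_mul_cancel₀ _ (hC0 x)]
      exact ((hd.differentiableAt (hUo.mem_nhds (hreal x))).hasDerivAt).comp_ofReal)
    (hdcont.div hcont hC0)
    (fun x => by
      push_cast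
      rw [hdper, hf, fourierSum_periodic])
    (fun x => by push_cast; exact fourierSum_periodic c x)
    (hC0 0)
    ((differentiable_log_one_sub hξi).sub (differentiable_log_one_sub hηi))
    (Summable.of_nonneg_of_le (fun _ => norm_nonneg _) (fun n => by
      refine (norm_add_le _ _).trans ?_
      rw [norm_neg]) ((hgeom _ hξi).add (hgeom _ hηi)))
    (by simp [ha])
    (fun x => ((hasSum_log_one_sub hξi x).sub (hasSum_log_one_sub hηi x)).congr_fun fun n => by
      simp only [ha]; ring)
    (fun x => by
      have h1 := hfe x
      rw [← hsum, ← hsum', sub_joukowski_eq (expChar_ne_zero _) hξ0,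
        sub_joukowski_eq (expChar_ne_zero _) hη0] at h1
      have n1 := one_sub_mul_ne_zero (hz1 x) hξi
      have n2 := one_sub_mul_ne_zero (hz1' x) hξi
      have n3 := one_sub_mul_ne_zero (hz1 x) hηi
      have n4 := one_sub_mul_ne_zero (hz1' x) hηi
      rw [Complex.exp_sub, Complex.exp_add, Complex.exp_add, Complex.exp_log n1,
        Complex.exp_log n2, Complex.exp_log n3, Complex.exp_log n4]
      have hθ0 := expChar_ne_zero θ
      generalize (1 - expChar x * ξ⁻¹) = A at *
      generalize (1 - (expChar x)⁻¹ * ξ⁻¹) = A' at *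
      generalize (1 - expChar x * η⁻¹) = B at *
      generalize (1 - (expChar x)⁻¹ * η⁻¹) = B' at *
      field_simp
      linear_combination -h1)
  have hγ : 0 < Real.log ‖ξ‖ := Real.log_pos hξ
  refine delta_lt_of_norm_le (C := B / 4) hα hγ hs0 k fun n hn => ?_
  have hn0 : (n : ℂ) ≠ 0 := by exact_mod_cast hn.ne'
  have hhalf : expChar (1 / 2) = -1 := by
    have : expChar (1 / 2) = Complex.exp (Real.pi * Complex.I) := by
      rw [expChar]; congr 1; ring
    rw [this, Complex.exp_pi_mul_I]
  -- The sign in `κ` is the source of the shift of `θ` by `1/2`.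
  have hratio : expChar (θ - 1 / 2 + k * α : ℝ) = ξ / η := by
    have e1 : ((θ - 1 / 2 + k * α : ℝ) : ℂ) = θ + (-(1 / 2) + k * α) := by push_cast; ring
    have hθ0 := expChar_ne_zero θ
    rw [e1, expChar_add, expChar_add, expChar_neg, hhalf, ← hκ]
    field_simp
  have hna : (n : ℂ) * a n = ξ⁻¹ ^ n * (expChar (n * (θ - 1 / 2 + k * α) : ℝ) - 1) := by
    have e1 := expChar_int_mul n ((θ - 1 / 2 + k * α : ℝ) : ℂ)
    rw [hratio, zpow_natCast, Int.cast_natCast] at e1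
    have e2 : ((n * (θ - 1 / 2 + k * α) : ℝ) : ℂ) = n * (θ - 1 / 2 + k * α : ℝ) := by
      push_cast; ring
    rw [e2, e1]
    simp only [ha, Int.natAbs_natCast, div_pow, inv_pow]
    field_simp
    ring
  have hcn := hcoef n
  rw [Int.cast_natCast, mul_assoc _ (n : ℂ), hna] at hcn
  have hnorm := congrArg norm hcn
  have e3 : ((n : ℂ) * α) = ((n * α : ℝ) : ℂ) := by push_cast; ring
  rw [e3, norm_mul, norm_mul, norm_mul, norm_mul, norm_mul, Complex.norm_I, Complex.norm_ofNat,
    Complex.norm_real, Real.norm_of_nonneg Real.pi_pos.le, mul_one, norm_pow, norm_inv] at hnorm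
  have hlow := (norm_expChar_sub_one_bounds (n * (θ - 1 / 2 + k * α))).1
  have hup := (norm_expChar_sub_one_bounds (n * α)).2
  have hpi := Real.pi_pos
  have hξn : 0 < ‖ξ‖ ^ n := by positivity
  have hpow : Real.exp ((Real.log ‖ξ‖ - s) * n) = ‖ξ‖ ^ n * Real.exp (-s * n) := by
    rw [sub_mul, sub_eq_add_neg, Real.exp_add, mul_comm (Real.log ‖ξ‖), Real.exp_nat_mul,
      Real.exp_log (zero_lt_one.trans hξ), neg_mul]
  have hBn := hB n
  -- The `2π` on the left stems from differentiation and cancels the upper chord bound; the `4` from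
  -- the lower chord bound produces the constant `B / 4`.
  have hchain : 2 * Real.pi * (‖ξ‖⁻¹ ^ n *
      (4 * ‖((n * (θ - 1 / 2 + k * α) : ℝ) : UnitAddCircle)‖)) ≤
      B * Real.exp (-s * n) * (2 * Real.pi * ‖((n * α : ℝ) : UnitAddCircle)‖) := by
    calc _ ≤ 2 * Real.pi * (‖ξ‖⁻¹ ^ n * ‖expChar (n * (θ - 1 / 2 + k * α) : ℝ) - 1‖) := by gcongr
      _ = _ := hnorm.symm
      _ ≤ _ := mul_le_mul hBn hup (norm_nonneg _) ((norm_nonneg _).trans hBn)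
  rw [hpow]
  rw [inv_pow] at hchain
  have h2 := mul_le_mul_of_nonneg_left hchain (by positivity : 0 ≤ ‖ξ‖ ^ n / (8 * Real.pi))
  calc _ = ‖ξ‖ ^ n / (8 * Real.pi) * (2 * Real.pi * ((‖ξ‖ ^ n)⁻¹ *
      (4 * ‖((n * (θ - 1 / 2 + k * α) : ℝ) : UnitAddCircle)‖))) := by field_simp; ring
    _ ≤ _ := h2
    _ = _ := by field_simp; ring

end

end Maryland

theorem proposition3p2 (lam α θ : ℝ) (hlam : 0 < lam) (hα : Irrational α)
    (hθ : ∀ m n : ℤ, θ ≠ 1 / 2 + m * α + n) :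
    (∀ e : ℝ, Maryland.HasExpDecayingEigenfunction lam α θ e →
      Maryland.delta α θ < (Maryland.lyapunovExponent lam α e : EReal)) ∧
    {e : ℝ | (Maryland.lyapunovExponent lam α e : EReal) = Maryland.delta α θ}.encard ≤ 2 ∧
    (∀ e : ℝ, (Maryland.lyapunovExponent lam α e : EReal) = Maryland.delta α θ →
      ¬ Maryland.HasExpDecayingEigenfunction lam α θ e) := by
  refine ⟨fun e he => Maryland.hasExpDecayingEigenfunction_delta_lt hlam hα hθ he,
    Maryland.encard_lyapunovExponent_fiber_le hlam α _, fun e he h => ?_⟩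
  exact (Maryland.hasExpDecayingEigenfunction_delta_lt hlam hα hθ h).ne' he
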